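/- **Objects.** Label the vertices of a convex $n$-gon $1,\dots,n$ clockwise and write $(a,b)$, $a<b$, for the diagonal joining $a$ and $b$. A *2-triangulation* of the $n$-gon is a maximal set of diagonals containing no three that pairwise cross in their interiors. Its *diagram* $D$ is its set of nontrivial diagonals, i.e. diagonals with at least two vertices strictly between their endpoints on each side; $(a,b)\in D$ is drawn as a cross in row $a$ and column $b$ ($4\le b\le n$). A *Dyck path of size $m$* is a lattice path with steps $N=(0,1)$, $E=(1,0)$ from $(0,0)$ to $(m,m)$ that never goes below $y=x$. **The tree of 2-triangulations.** Level $\ell\ge 0$ consists of the 2-triangulations of an $(\ell+5)$-gon. For $n\ge 6$, the parent of a 2-triangulation of an $n$-gon with diagram $D$ is the 2-triangulation of an $(n-1)$-gon whose diagram is obtained as follows. Let $r$ be the largest number with $1\le r\le n-3$ and $(r,r+3)\in D$, and let degrees be counted in $D$. Delete $(r,r+3)$. Then, if $\deg(r+1)=0$, delete $(r-1,r+2)$; otherwise, if $\deg(r+2)=0$, delete $(1,r+1)$; otherwise delete $(j,r+2)$, where $j=\max\{a<r:(a,r+2)\in D\}$. Finally contract the side $(r+1,r+2)$, i.e. replace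 each label $v>r+1$ by $v-1$. **The tree of pairs of Dyck paths.** Level $\ell\ge 0$ consists of the pairs $(P,Q)$ of Dyck paths of size $\ell+1$ such that $P$ never goes below $Q$. For $m\ge 2$, write a pair of size $m$ as $P=NE^{p_m}\cdots NE^{p_2}NE^{p_1}E$ and $Q=NE^{q_m}\cdots NE^{q_2}NE^{q_1}E$, put $p_j=q_j=0$ for $j>m$, and let $s=\min\{j\ge 2: p_jq_j=0\}$. The parent is the pair $(P',Q')$ of size $m-1$ given in the same way by the first $m-1$ terms of the sequences $$p'=(p_1,\dots,p_{s-2},\;p_{s-1}-1,\;p_s+p_{s+1},\;p_{s+2},\dots),\qquad q'=(q_1,\dots,q_{s-2},\;q_{s-1}+q_s-1,\;q_{s+1},\dots).$$ **The coloring algorithm.** Let $n\ge 5$ and let $D$ be the diagram of a 2-triangulation of the $n$-gon. Start with blocks $1,\dots,n-3$, block $j$ consisting of column $j+3$, and repeat $n-5$ times: let $r$ be the largest index such that row $r$ has a cross (colored or not) in block $r$; color blue a leftmost uncolored cross in block $r$; merge blocks $r-2$ and $r-1$ and renumber the blocks (if $r=2$, block $1$ is merged into a "block $0$", initially empty, which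 is not counted among the blocks); color red a rightmost uncolored cross in the merged block. Ties are broken arbitrarily. If at the end column $j$ has $\alpha_j$ blue and $\beta_j$ red crosses, the output is $$P=NE^{\alpha_5}NE^{\alpha_6}\cdots NE^{\alpha_n}E,\qquad Q=NE^{\beta_4}NE^{\beta_5}\cdots NE^{\beta_{n-1}}E.$$ **Theorem.** Both parent rules define rooted trees: each level $0$ has exactly one node, and every node at level $\ell+1$ has exactly one parent, which is a node at level $\ell$. The two trees are isomorphic: there are bijections $\Psi_\ell$ from the 2-triangulations of an $(\ell+5)$-gon to the pairs of Dyck paths of size $\ell+1$ with the first never below the second, for all $\ell\ge 0$, such that $T'$ is the parent of $T$ if and only if $\Psi_\ell(T')$ is the parent of $\Psi_{\ell+1}(T)$. Moreover, the isomorphism can be chosen such that $\Psi_\ell(T)$ is computed by the coloring algorithm: for every 2-triangulation $T$ of an $(\ell+5)$-gon, the algorithm never gets stuck, and, however ties are broken, at the end all crosses are colored and the output is $\Psi_\ell(T)$. In particular, for every $n\ge 5$ the coloring algorithm gives a bijection between the 2-triangulations of a convex $n$-gon and the pairs $(P,Q)$ of Dyck paths of size $n-4$ with $P$ never below $Q$.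 -/

import Mathlib

namespace GenTree

/-! ## Generating trees -/

/-- A levelled set of nodes with a parent relation between consecutive levels:
`IsParent ℓ x y` means that `y`, at level `ℓ`, is the parent of `x`, at level `ℓ + 1`. -/
structure Levelled where
  Node : ℕ → Type
  IsParent : ∀ ℓ, Node (ℓ + 1) → Node ℓ → Prop

/-- There is exactly one node at level `0` (the root), and each node at a positive level
has exactly one parent, which lies on the previous level. -/
def Levelled.IsRootedTree (X : Levelled) : Prop :=
  (∃! _x : X.Node 0, True) ∧ ∀ ℓ (x : X.Node (ℓ + 1)), ∃! y : X.Node ℓ, X.IsParent ℓ x y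

/-- Isomorphisms: level-preserving bijections that preserve and reflect the parent relation. -/
structure Levelled.Iso (X Y : Levelled) where
  toEquiv : ∀ ℓ, X.Node ℓ ≃ Y.Node ℓ
  isParent_iff : ∀ ℓ (x : X.Node (ℓ + 1)) (y : X.Node ℓ),
    X.IsParent ℓ x y ↔ Y.IsParent ℓ (toEquiv (ℓ + 1) x) (toEquiv ℓ y)

/-! ## Generalized triangulations

The vertices of a convex `n`-gon are labelled `1, …, n` clockwise, and the segment joining the
vertices `a < b` is the pair `(a, b)`. -/

/-- The diagonals of the `n`-gon: all segments between two vertices, except the sides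
`(a, a + 1)` and `(1, n)`. -/
def diagonals (n : ℕ) : Finset (ℕ × ℕ) :=
  (Finset.Icc 1 n ×ˢ Finset.Icc 1 n).filter
    fun d => d.1 + 1 < d.2 ∧ ¬(d.1 = 1 ∧ d.2 = n)

/-- Two diagonals of a convex polygon intersect in their interiors. -/
def Cross (d e : ℕ × ℕ) : Prop :=
  (d.1 < e.1 ∧ e.1 < d.2 ∧ d.2 < e.2) ∨ (e.1 < d.1 ∧ d.1 < e.2 ∧ e.2 < d.2)

/-- `T` contains an `m`-crossing: `m` diagonals any two of which cross. -/
def HasCrossing (m : ℕ) (T : Finset (ℕ × ℕ)) : Prop :=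
  ∃ S ⊆ T, S.card = m ∧ (S : Set (ℕ × ℕ)).Pairwise Cross

/-- `T` is a `k`-triangulation of the `n`-gon: a maximal set of diagonals without
`(k + 1)`-crossing. -/
def IsTriangulation (k n : ℕ) (T : Finset (ℕ × ℕ)) : Prop :=
  Maximal (fun T' => T' ⊆ diagonals n ∧ ¬HasCrossing (k + 1) T') T

/-- The `2`-triangulations of the `n`-gon. -/
def TwoTriangulation (n : ℕ) : Type :=
  {T : Finset (ℕ × ℕ) // IsTriangulation 2 n T}

/-- The shape `Λ_n`: the diagonals `(a, b)` with at least two vertices strictly between their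
endpoints on both sides, that is, the nontrivial ones. -/
def shape (n : ℕ) : Finset (ℕ × ℕ) :=
  (diagonals n).filter fun d => d.1 + 3 ≤ d.2 ∧ d.2 + 3 ≤ d.1 + n

/-- The diagram of a `2`-triangulation: the set of its nontrivial diagonals. The element `(a, b)`
is drawn as a cross in row `a` and column `b` of `Λ_n`. -/
def diagram (n : ℕ) (T : Finset (ℕ × ℕ)) : Finset (ℕ × ℕ) := T ∩ shape n

/-- The degree of a vertex, in a set `D` of nontrivial diagonals. -/
def degree (D : Finset (ℕ × ℕ)) (v : ℕ) : ℕ := (D.filter fun d => d.1 = v ∨ d.2 = v).card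

/-- The corner: the largest `r` with `1 ≤ r ≤ n - 3` such that the short diagonal `(r, r + 3)`
is in `D`. -/
def corner (n : ℕ) (D : Finset (ℕ × ℕ)) : ℕ :=
  ((Finset.Icc 1 (n - 3)).filter fun a => (a, a + 3) ∈ D).sup id

/-- The largest `j` with `1 ≤ j < r` such that `(j, r + 2)` is in `D`. -/
def lastBelow (D : Finset (ℕ × ℕ)) (r : ℕ) : ℕ :=
  ((Finset.Ico 1 r).filter fun a => (a, r + 2) ∈ D).sup id

/-- The second diagonal that is deleted when one passes to the parent; `r` is the corner. -/
def secondDeleted (D : Finset (ℕ × ℕ)) (r : ℕ) : ℕ × ℕ :=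
  if degree D (r + 1) = 0 then (r - 1, r + 2)
  else if degree D (r + 2) = 0 then (1, r + 1)
  else (lastBelow D r, r + 2)

/-- The effect on vertex labels of contracting the side `(r + 1, r + 2)`. -/
def contract (r v : ℕ) : ℕ := if v ≤ r + 1 then v else v - 1

/-- The diagram of the parent of a `2`-triangulation of the `n`-gon with diagram `D`, for `6 ≤ n`:
delete the corner `(r, r + 3)` and a second diagonal, then contract the side `(r + 1, r + 2)`. -/
def parentDiagram (n : ℕ) (D : Finset (ℕ × ℕ)) : Finset (ℕ × ℕ) :=
  let r := corner n D
  ((D.erase (r, r + 3)).erase (secondDeleted D r)).image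
    fun d => (contract r d.1, contract r d.2)

/-- The generating tree for `2`-triangulations; level `ℓ` consists of the `2`-triangulations of
the `(ℓ + 5)`-gon. -/
def triangulationTree : Levelled where
  Node ℓ := TwoTriangulation (ℓ + 5)
  IsParent ℓ T T' :=
    diagram (ℓ + 5) T'.1 = parentDiagram (ℓ + 6) (diagram (ℓ + 6) T.1)

/-! ## Pairs of non-crossing Dyck paths

Paths are words in the north step `N = U` and the east step `E = D`. Thus a `DyckWord` is a path
from `(0, 0)` to `(m, m)`, with `m` its semilength, which never goes below the diagonal `y = x`. -/

/-- The path `P` never goes below `Q` (both start at the origin): after each number of steps, `P`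
has made at least as many north steps as `Q`, i.e. on each line `x + y = t` the point of `P` lies
weakly to the north-west of the point of `Q`. -/
def NeverBelow (P Q : List DyckStep) : Prop :=
  ∀ t, (Q.take t).count DyckStep.U ≤ (P.take t).count DyckStep.U

/-- Pairs `(P, Q)` of Dyck paths of size `m` such that `P` never goes below `Q`. -/
def DyckPair (m : ℕ) : Type :=
  {w : DyckWord × DyckWord //
    w.1.semilength = m ∧ w.2.semilength = m ∧ NeverBelow w.1.toList w.2.toList}

/-- The path `N E^(f 0) N E^(f 1) ⋯ N E^(f (m - 1)) E`. -/
def path (m : ℕ) (f : ℕ → ℕ) : List DyckStep :=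
  (List.range m).flatMap (fun i => DyckStep.U :: List.replicate (f i) DyckStep.D) ++ [DyckStep.D]

/-- The number of east steps of `w` with ordinate `y`. -/
def eastSteps (w : List DyckStep) (y : ℕ) : ℕ :=
  ((Finset.range w.length).filter
    fun i => w[i]? = some DyckStep.D ∧ (w.take i).count DyckStep.U = y).card

/-- The numbers `p_1, …, p_m` for which the Dyck path `w` of size `m` is
`N E^(p_m) N E^(p_(m-1)) ⋯ N E^(p_1) E`, extended by `p_j = 0` for `j = 0` and `j > m`. -/
def code (m : ℕ) (w : List DyckStep) (j : ℕ) : ℕ :=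
  if j = 0 ∨ m < j then 0
  else if j = 1 then eastSteps w m - 1
  else eastSteps w (m + 1 - j)

/-- The path with code `p_1, …, p_m`. -/
def ofCode (m : ℕ) (p : ℕ → ℕ) : List DyckStep := path m fun i => p (m - i)

/-- `s = min {j ≥ 2 : p_j q_j = 0}`. -/
noncomputable def splitIndex (p q : ℕ → ℕ) : ℕ := sInf {j | 2 ≤ j ∧ p j * q j = 0}

/-- The code of the first path of the parent:
`p_1, …, p_(s-2), p_(s-1) - 1, p_s + p_(s+1), p_(s+2), …`. -/
def parentUpper (s : ℕ) (p : ℕ → ℕ) (j : ℕ) : ℕ :=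
  if j + 1 < s then p j
  else if j + 1 = s then p j - 1
  else if j = s then p s + p (s + 1)
  else p (j + 1)

/-- The code of the second path of the parent:
`q_1, …, q_(s-2), q_(s-1) + q_s - 1, q_(s+1), …`. -/
def parentLower (s : ℕ) (q : ℕ → ℕ) (j : ℕ) : ℕ :=
  if j + 1 < s then q j
  else if j + 1 = s then q j + q s - 1
  else q (j + 1)

/-- The parent of the pair `(P, Q)` of Dyck paths of size `m`, for `2 ≤ m`. -/
noncomputable def parentPaths (m : ℕ) (P Q : List DyckStep) : List DyckStep × List DyckStep :=
  let p := code m P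
  let q := code m Q
  let s := splitIndex p q
  (ofCode (m - 1) (parentUpper s p), ofCode (m - 1) (parentLower s q))

/-- The generating tree for pairs of non-crossing Dyck paths; level `ℓ` consists of the pairs of
size `ℓ + 1`. -/
noncomputable def dyckTree : Levelled where
  Node ℓ := DyckPair (ℓ + 1)
  IsParent ℓ w w' :=
    (w'.1.1.toList, w'.1.2.toList) = parentPaths (ℓ + 2) w.1.1.toList w.1.2.toList

/-! ## The coloring algorithm -/

/-- A state of the coloring algorithm: the index of the block to which each column belongs
(index `0` for columns that have disappeared), and the crosses colored blue and red so far. -/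
structure Coloring where
  block : ℕ → ℕ
  blue : Finset (ℕ × ℕ)
  red : Finset (ℕ × ℕ)

/-- At the beginning block `j` consists of column `j + 3`, and nothing is colored. -/
def Coloring.init : Coloring := ⟨fun j => j - 3, ∅, ∅⟩

/-- The crosses of `D` that are not yet colored and lie in block `i`. -/
def Coloring.uncolored (D : Finset (ℕ × ℕ)) (S : Coloring) (i : ℕ) : Finset (ℕ × ℕ) :=
  (D \ (S.blue ∪ S.red)).filter fun c => S.block c.2 = i

/-- Merge blocks `r - 2` and `r - 1`, for `2 ≤ r`; the merged block has index `r - 2`. -/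
def Coloring.merge (S : Coloring) (r : ℕ) : Coloring :=
  { S with block := fun j => if r - 1 ≤ S.block j then S.block j - 1 else S.block j }

/-- One iteration. Let `r` be the largest index such that row `r` has a cross (colored or not) in
block `r`; color blue a leftmost uncolored cross `x` of block `r`; merge blocks `r - 2` and
`r - 1`; color red a rightmost uncolored cross `y` of the merged block. Ties are broken
arbitrarily. -/
def Coloring.Step (D : Finset (ℕ × ℕ)) (S S' : Coloring) : Prop :=
  ∃ (r : ℕ) (x y : ℕ × ℕ),
    2 ≤ r ∧ IsGreatest {i | ∃ c ∈ D, c.1 = i ∧ S.block c.2 = i} r ∧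
    x ∈ S.uncolored D r ∧ (∀ c ∈ S.uncolored D r, x.2 ≤ c.2) ∧
    let M := ({ S with blue := insert x S.blue } : Coloring).merge r
    y ∈ M.uncolored D (r - 2) ∧ (∀ c ∈ M.uncolored D (r - 2), c.2 ≤ y.2) ∧
    S' = { M with red := insert y M.red }

/-- `Reach D i S`: the state `S` is a possible result of `i` iterations. -/
inductive Coloring.Reach (D : Finset (ℕ × ℕ)) : ℕ → Coloring → Prop
  | init : Reach D 0 Coloring.init
  | step {i : ℕ} {S S' : Coloring} : Reach D i S → Coloring.Step D S S' → Reach D (i + 1) S'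

/-- The number of elements of `C` in column `j`. -/
def columnCount (C : Finset (ℕ × ℕ)) (j : ℕ) : ℕ := (C.filter fun c => c.2 = j).card

/-- `P = N E^(α_5) N E^(α_6) ⋯ N E^(α_n) E`, where `α_j` counts the blue crosses in column `j`. -/
def Coloring.upperPath (n : ℕ) (S : Coloring) : List DyckStep :=
  path (n - 4) fun i => columnCount S.blue (i + 5)

/-- `Q = N E^(β_4) N E^(β_5) ⋯ N E^(β_(n-1)) E`, where `β_j` counts the red crosses in column
`j`. -/
def Coloring.lowerPath (n : ℕ) (S : Coloring) : List DyckStep :=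
  path (n - 4) fun i => columnCount S.red (i + 4)

/-- The coloring algorithm, run on a `2`-triangulation of the `n`-gon with diagram `D`, never gets
stuck during its `n - 5` iterations, and, however ties are broken, at the end all crosses are
colored and the resulting paths are `P` and `Q`. -/
def AlgorithmYields (n : ℕ) (D : Finset (ℕ × ℕ)) (P Q : List DyckStep) : Prop :=
  (∀ i < n - 5, ∀ S, Coloring.Reach D i S → ∃ S', Coloring.Step D S S') ∧
  ∀ S, Coloring.Reach D (n - 5) S →
    S.blue ∪ S.red = D ∧ S.upperPath n = P ∧ S.lowerPath n = Q

end GenTree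

/-!
In both trees a node on a positive level is the same as its parent together with two numbers, and
the coloring algorithm matches these data.

*Triangulations.* All trivial diagonals belong to a `2`-triangulation `T`, and with them the parent
rule becomes uniform. Below every nontrivial diagonal there is a diagonal `(c, c + 3)`
(`Tri.exists_short`), so the rows below the corner `r` contain trivial diagonals only. If `j` is the
first neighbour of `r + 1`, then maximality forces `(j, r + 2) ∈ T` (`Tri.exists_star`), while the
`3`-crossings with the corner `(r, r + 3)` force the neighbours of `r + 1` to come weakly after `j`
and the other neighbours of `r + 2` except `r` to come weakly before it. Hence the contraction of
the side `(r + 1, r + 2)` identifies `(j, r + 1)` with `(j, r + 2)`, turns the trivial diagonals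
`(r, r + 2)` and `(r + 1, r + 3)` into sides, and is injective otherwise; the three cases of
the parent rule only depend on whether one of the diagonals `(j, r + 1)` and `(j, r + 2)` is trivial
(`parentDiagram_eq`). Crossings lift and descend along the contraction, so that it preserves
maximality (`Tri.flat`), and so does its inverse, which splits the vertex `r + 1` along `(j, r + 1)`
(`Tri.inflate`). A `2`-triangulation is therefore the same as its
parent together with `r` and a position `j` in column `r + 1` of the parent, and `j` may be replaced
by the size of the column `r + 2` of the diagram (`eq_of_flat_eq`, `exists_inflate`).

*Dyck paths.* A pair of paths is encoded by the pair of its codes, and the non-crossing condition by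
inequalities between tail sums (`IsPairCode`). A pair of codes is the same as its parent together
with the split index `s` and the number `p_s + q_(s-1)` (`IsPairCode.parent`,
`IsPairCode.of_parent`, `eq_of_parent_eq`).

*The algorithm.* It depends on the numbers of crosses in the columns only, and in terms of these it
is deterministic (`Counts.Step.unique`). After its first iteration, which treats the corner, its run
on a diagram simulates its run on the diagram of the parent (`Sim`): column `r + 1` of the parent is
represented by the merged columns `r + 1` and `r + 2`, of which blue crosses fill the left one first
and red crosses the right one. So the numbers of blue and red crosses of a diagram and of its parent
are related by the parent rule for codes, with `s = n - 1 - r`, and `p_s + q_(s-1)` is the number of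
crosses in column `r + 2` (`HasCode.of_flat`). Induction on the level now shows that the algorithm
computes a bijection that respects parents.
-/

namespace GenTree

/-! ### Words in north and east steps -/

/-- The word `N E^(g 0) N E^(g 1) ⋯ N E^(g (m - 1))`. -/
def stairs (m : ℕ) (g : ℕ → ℕ) : List DyckStep :=
  (List.range m).flatMap fun i => DyckStep.U :: List.replicate (g i) DyckStep.D

lemma stairs_succ (m : ℕ) (g : ℕ → ℕ) :
    stairs (m + 1) g = stairs m g ++ DyckStep.U :: List.replicate (g m) DyckStep.D := by
  simp [stairs, List.range_succ]

lemma stairs_congr {m : ℕ} {g g' : ℕ → ℕ} (h : ∀ i < m, g i = g' i) :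
    stairs m g = stairs m g' := by
  induction m with
  | zero => rfl
  | succ m ih => rw [stairs_succ, stairs_succ, ih fun i hi => h i (by omega), h m (by omega)]

lemma path_eq_stairs {m : ℕ} (hm : 1 ≤ m) (f : ℕ → ℕ) :
    path m f = stairs m fun i => if i + 1 = m then f i + 1 else f i := by
  obtain ⟨k, rfl⟩ : ∃ k, m = k + 1 := ⟨m - 1, by omega⟩
  have h : path (k + 1) f = stairs (k + 1) f ++ [DyckStep.D] := rfl
  have h' : stairs k (fun i => if i + 1 = k + 1 then f i + 1 else f i) = stairs k f :=
    stairs_congr fun i hi => if_neg (by omega)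
  rw [h, stairs_succ, stairs_succ, h']
  simp [List.replicate_succ']

lemma path_congr {m : ℕ} {f f' : ℕ → ℕ} (h : ∀ i < m, f i = f' i) : path m f = path m f' := by
  change stairs m f ++ _ = stairs m f' ++ _
  rw [stairs_congr h]

lemma count_U_stairs (m : ℕ) (g : ℕ → ℕ) : (stairs m g).count DyckStep.U = m := by
  induction m with
  | zero => rfl
  | succ m ih => simp [stairs_succ, ih, List.count_replicate]

lemma count_D_stairs (m : ℕ) (g : ℕ → ℕ) :
    (stairs m g).count DyckStep.D = ∑ i ∈ Finset.range m, g i := by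
  induction m with
  | zero => rfl
  | succ m ih => simp [stairs_succ, ih, Finset.sum_range_succ]

lemma length_stairs (m : ℕ) (g : ℕ → ℕ) :
    (stairs m g).length = m + ∑ i ∈ Finset.range m, g i := by
  induction m with
  | zero => rfl
  | succ m ih => simp [stairs_succ, ih, Finset.sum_range_succ]; omega

lemma stairs_eq_append {y m : ℕ} (g : ℕ → ℕ) (h : y < m) :
    ∃ v, stairs m g = stairs y g ++ DyckStep.U :: v := by
  induction m with
  | zero => omega
  | succ m ih =>
    rcases Nat.lt_succ_iff_lt_or_eq.mp h with h' | rfl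
    · obtain ⟨v, hv⟩ := ih h'
      exact ⟨_, by rw [stairs_succ, hv, List.append_assoc, List.cons_append]⟩
    · exact ⟨_, stairs_succ _ _⟩

/-- The north step number `y` (counted from `0`) of `stairs m g` is its letter number
`y + ∑ i < y, g i`. -/
lemma lt_count_take_stairs {y m : ℕ} (g : ℕ → ℕ) (h : y < m) (t : ℕ) :
    y < ((stairs m g).take t).count DyckStep.U ↔ y + ∑ i ∈ Finset.range y, g i < t := by
  obtain ⟨v, hv⟩ := stairs_eq_append g h
  rw [← length_stairs, hv]
  constructor
  · intro hy
    by_contra! ht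
    rw [List.take_append_of_le_length ht] at hy
    have := ((stairs y g).take_sublist t).count_le DyckStep.U
    rw [count_U_stairs] at this
    omega
  · intro ht
    obtain ⟨k, rfl⟩ : ∃ k, t = (stairs y g).length + (k + 1) :=
      ⟨t - (stairs y g).length - 1, by omega⟩
    rw [List.take_length_add_append, List.count_append, count_U_stairs]
    simp

lemma neverBelow_stairs {m : ℕ} {f g : ℕ → ℕ} :
    NeverBelow (stairs m f) (stairs m g) ↔
      ∀ y < m, ∑ i ∈ Finset.range y, f i ≤ ∑ i ∈ Finset.range y, g i := by
  constructor
  · intro h y hy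
    have h1 := h (y + ∑ i ∈ Finset.range y, g i + 1)
    have h2 := (lt_count_take_stairs g hy (y + ∑ i ∈ Finset.range y, g i + 1)).2 (by omega)
    have h3 := (lt_count_take_stairs f hy _).1 (h2.trans_le h1)
    omega
  · intro h t
    by_contra! hlt
    set y := ((stairs m f).take t).count DyckStep.U with hy
    have hm : y < m := by
      have := ((stairs m g).take_sublist t).count_le DyckStep.U
      rw [count_U_stairs] at this
      omega
    have h1 := (lt_count_take_stairs g hm t).1 hlt
    have h2 := (lt_count_take_stairs f hm t).2 (by have := h y hm; omega)
    omega

/-- A word with `m` steps of each kind that starts with `N`, or is empty, is a Dyck word if and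
only if there are at most `y` east steps before the north step number `y`. -/
lemma isDyck_stairs {m : ℕ} {g : ℕ → ℕ} (hg : ∑ i ∈ Finset.range m, g i = m) :
    (∀ t, ((stairs m g).take t).count DyckStep.D ≤ ((stairs m g).take t).count DyckStep.U) ↔
      ∀ y < m, ∑ i ∈ Finset.range y, g i ≤ y := by
  constructor
  · intro h y hy
    obtain ⟨v, hv⟩ := stairs_eq_append g hy
    have := h (stairs y g).length
    rwa [hv, List.take_left, count_U_stairs, count_D_stairs] at this
  · intro h t
    set y := ((stairs m g).take t).count DyckStep.U with hy
    rcases lt_or_ge y m with hm | hm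
    · have h1 := (lt_count_take_stairs g hm t).not.1 (by omega)
      obtain ⟨v, hv⟩ := stairs_eq_append g hm
      rw [← length_stairs] at h1
      rw [hv, List.take_append_of_le_length (by omega)]
      have := ((stairs y g).take_sublist t).count_le DyckStep.D
      rw [count_D_stairs] at this
      exact this.trans (h y hm)
    · have := ((stairs m g).take_sublist t).count_le DyckStep.D
      rw [count_D_stairs, hg] at this
      omega

lemma eastSteps_append_singleton (w : List DyckStep) (a : DyckStep) (y : ℕ) :
    eastSteps (w ++ [a]) y =
      eastSteps w y + if a = DyckStep.D ∧ w.count DyckStep.U = y then 1 else 0 := by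
  unfold eastSteps
  rw [List.length_append, List.length_singleton, Finset.range_add_one, Finset.filter_insert]
  have h : (Finset.range w.length).filter (fun i => (w ++ [a])[i]? = some DyckStep.D ∧
      ((w ++ [a]).take i).count DyckStep.U = y) = (Finset.range w.length).filter
      (fun i => w[i]? = some DyckStep.D ∧ (w.take i).count DyckStep.U = y) := by
    refine Finset.filter_congr fun i hi => ?_
    have hi := Finset.mem_range.1 hi
    rw [List.getElem?_append_left hi, List.take_append_of_le_length hi.le]
  rw [h]
  simp only [List.getElem?_concat_length, Option.some.injEq, List.take_left]
  split_ifs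
  · rw [Finset.card_insert_of_notMem (by simp)]
  · rfl

lemma eastSteps_replicate (w : List DyckStep) (k y : ℕ) :
    eastSteps (w ++ List.replicate k DyckStep.D) y =
      eastSteps w y + if w.count DyckStep.U = y then k else 0 := by
  induction k with
  | zero => simp
  | succ k ih =>
    rw [List.replicate_succ', ← List.append_assoc, eastSteps_append_singleton, ih]
    simp [List.count_replicate]
    split_ifs <;> omega

lemma eastSteps_stairs (m : ℕ) (g : ℕ → ℕ) (y : ℕ) :
    eastSteps (stairs m g) y = if 1 ≤ y ∧ y ≤ m then g (y - 1) else 0 := by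
  induction m with
  | zero =>
    have : ¬(1 ≤ y ∧ y ≤ 0) := by omega
    rw [if_neg this]; rfl
  | succ m ih =>
    have : stairs m g ++ DyckStep.U :: List.replicate (g m) DyckStep.D =
      (stairs m g ++ [DyckStep.U]) ++ List.replicate (g m) DyckStep.D := by simp
    rw [stairs_succ, this, eastSteps_replicate, eastSteps_append_singleton, ih]
    simp only [List.count_append, count_U_stairs, reduceCtorEq, false_and, if_false]
    simp only [List.count_singleton_self, Nat.add_zero]
    rcases Nat.lt_trichotomy y (m + 1) with h | rfl | h
    · split_ifs <;> omega
    · simp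
    · split_ifs <;> omega

/-- A word that is empty or starts with `N` is determined by the numbers of its east steps on the
levels `1, …, m`, with `m` the number of its north steps. -/
lemma eq_stairs_of_head (w : List DyckStep) (hw : ∀ a ∈ w.head?, a = DyckStep.U) :
    w = stairs (w.count DyckStep.U) fun i => eastSteps w (i + 1) := by
  induction w using List.reverseRecOn with
  | nil => rfl
  | append_singleton w a ih =>
    rcases List.eq_nil_or_concat w with rfl | hne
    · have : a = DyckStep.U := hw a (by simp)
      subst this
      rfl
    · have hw' : ∀ a ∈ w.head?, a = DyckStep.U := by
        intro b hb
        refine hw b ?_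
        rw [List.head?_append]
        rw [Option.mem_def] at hb
        rw [hb]
        rfl
      have ih := ih hw'
      set m := w.count DyckStep.U with hm
      have hpos : 0 < m := by
        rw [hm, List.count_pos_iff]
        cases w with
        | nil => simp at hne
        | cons b v => rw [hw' b (by simp)]; exact List.mem_cons_self
      cases a with
      | U =>
        rw [List.count_append, List.count_singleton_self, stairs_succ]
        simp only [eastSteps_append_singleton]
        simp only [reduceCtorEq, false_and, if_false, Nat.add_zero]
        rw [← ih, show eastSteps w (m + 1) = 0 by rw [ih, eastSteps_stairs]; simp]
        rfl
      | D =>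
        obtain ⟨k, hk⟩ : ∃ k, m = k + 1 := ⟨m - 1, by omega⟩
        have h' : stairs k (fun i => eastSteps (w ++ [DyckStep.D]) (i + 1)) =
            stairs k fun i => eastSteps w (i + 1) :=
          stairs_congr fun i hi => by
            rw [eastSteps_append_singleton, if_neg (by omega), Nat.add_zero]
        have h'' : eastSteps (w ++ [DyckStep.D]) (k + 1) = eastSteps w (k + 1) + 1 := by
          rw [eastSteps_append_singleton, if_pos ⟨rfl, by omega⟩]
        rw [List.count_append, ← hm, hk]
        simp only [List.count_singleton, beq_iff_eq, reduceCtorEq, if_false, Nat.add_zero]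
        rw [stairs_succ, h', h'']
        rw [hk, stairs_succ] at ih
        conv_lhs => rw [ih]
        simp [List.replicate_succ']

/-! ### Pairs of Dyck paths and their codes -/

/-- The codes of the pairs of Dyck paths of size `m` whose first path never goes below the second.
The inequalities are those between the tail sums `A t = p_t + p_(t+1) + ⋯` and
`B t = q_t + q_(t+1) + ⋯`. -/
def IsPairCode (m : ℕ) (p q : ℕ → ℕ) : Prop :=
  1 ≤ m ∧ p 0 = 0 ∧ q 0 = 0 ∧ ∃ A B : ℕ → ℕ,
    (∀ t, A t = p t + A (t + 1)) ∧ (∀ t, B t = q t + B (t + 1)) ∧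
    (∀ t, m < t → A t = 0 ∧ B t = 0) ∧ A 1 + 1 = m ∧ B 1 + 1 = m ∧
    ∀ t, 2 ≤ t → t ≤ m → A t ≤ B t ∧ B t + t ≤ m + 1

/-- The numbers of east steps on the levels `1, …, m` of the path with code `p`. -/
def levelsOfCode (m : ℕ) (p : ℕ → ℕ) (i : ℕ) : ℕ :=
  if i + 1 = m then p (m - i) + 1 else p (m - i)

lemma ofCode_eq_stairs {m : ℕ} (hm : 1 ≤ m) (p : ℕ → ℕ) :
    ofCode m p = stairs m (levelsOfCode m p) := path_eq_stairs hm _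

lemma sum_levelsOfCode {m : ℕ} {p A : ℕ → ℕ} (hA : ∀ t, A t = p t + A (t + 1))
    (h0 : A (m + 1) = 0) {y : ℕ} (hy : y < m) :
    ∑ i ∈ Finset.range y, levelsOfCode m p i = A (m + 1 - y) := by
  induction y with
  | zero => simpa using h0.symm
  | succ y ih =>
    rw [Finset.sum_range_succ, ih (by omega), levelsOfCode, if_neg (by omega)]
    have := hA (m - y)
    rw [show m - y + 1 = m + 1 - y by omega] at this
    rw [show m + 1 - (y + 1) = m - y by omega]
    omega

lemma sum_levelsOfCode_self {m : ℕ} {p A : ℕ → ℕ} (hm : 1 ≤ m) (hA : ∀ t, A t = p t + A (t + 1))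
    (h0 : A (m + 1) = 0) :
    ∑ i ∈ Finset.range m, levelsOfCode m p i = A 1 + 1 := by
  obtain ⟨k, rfl⟩ : ∃ k, m = k + 1 := ⟨m - 1, by omega⟩
  rw [Finset.sum_range_succ, sum_levelsOfCode hA h0 (by omega), levelsOfCode, if_pos rfl]
  have := hA 1
  rw [show k + 1 + 1 - k = 1 + 1 by omega, show k + 1 - k = 1 by omega]
  omega

/-- The Dyck word with a given list of letters `stairs m g`. -/
def dyckOfStairs (m : ℕ) (g : ℕ → ℕ) (hg : ∑ i ∈ Finset.range m, g i = m)
    (h : ∀ y < m, ∑ i ∈ Finset.range y, g i ≤ y) : DyckWord where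
  toList := stairs m g
  count_U_eq_count_D := by rw [count_U_stairs, count_D_stairs, hg]
  count_D_le_count_U := (isDyck_stairs hg).2 h

lemma IsPairCode.exists_pair {m : ℕ} {p q : ℕ → ℕ} (h : IsPairCode m p q) :
    ∃ w : DyckPair m, w.1.1.toList = ofCode m p ∧ w.1.2.toList = ofCode m q := by
  obtain ⟨hm, -, -, A, B, hA, hB, hz, hA1, hB1, hAB⟩ := h
  have h0 := hz (m + 1) (by omega)
  have key : ∀ y < m, A (m + 1 - y) ≤ B (m + 1 - y) ∧ B (m + 1 - y) ≤ y := by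
    intro y hy
    rcases Nat.eq_zero_or_pos y with rfl | hy0
    · simp [h0]
    · have := hAB (m + 1 - y) (by omega) (by omega)
      omega
  refine ⟨⟨(dyckOfStairs m (levelsOfCode m p) ?_ ?_, dyckOfStairs m (levelsOfCode m q) ?_ ?_),
    count_U_stairs _ _, count_U_stairs _ _, ?_⟩, (ofCode_eq_stairs hm p).symm,
    (ofCode_eq_stairs hm q).symm⟩
  · rw [sum_levelsOfCode_self hm hA h0.1, hA1]
  · intro y hy
    rw [sum_levelsOfCode hA h0.1 hy]
    exact (key y hy).1.trans (key y hy).2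
  · rw [sum_levelsOfCode_self hm hB h0.2, hB1]
  · intro y hy
    rw [sum_levelsOfCode hB h0.2 hy]
    exact (key y hy).2
  · refine neverBelow_stairs.2 fun y hy => ?_
    rw [sum_levelsOfCode hA h0.1 hy, sum_levelsOfCode hB h0.2 hy]
    exact (key y hy).1

lemma code_ofCode {m : ℕ} {p : ℕ → ℕ} (hm : 1 ≤ m) (h0 : p 0 = 0) (hp : ∀ j, m < j → p j = 0) :
    code m (ofCode m p) = p := by
  funext j
  unfold code
  rw [ofCode_eq_stairs hm, eastSteps_stairs, eastSteps_stairs]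
  unfold levelsOfCode
  split_ifs <;> try omega
  · rename_i h
    rcases h with rfl | h
    · exact h0.symm
    · exact (hp j h).symm
  · subst j
    rw [show m - (m - 1) = 1 by omega]
    omega
  · congr 1
    omega

lemma IsPairCode.support {m : ℕ} {p q : ℕ → ℕ} (h : IsPairCode m p q) {j : ℕ} (hj : m < j) :
    p j = 0 ∧ q j = 0 := by
  obtain ⟨-, -, -, A, B, hA, hB, hz, -⟩ := h
  have := hA j
  have := hB j
  have := hz j hj
  omega

lemma IsPairCode.code_eq {m : ℕ} {p q : ℕ → ℕ} (h : IsPairCode m p q) :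
    code m (ofCode m p) = p ∧ code m (ofCode m q) = q :=
  ⟨code_ofCode h.1 h.2.1 fun _ hj => (h.support hj).1,
    code_ofCode h.1 h.2.2.1 fun _ hj => (h.support hj).2⟩

/-- A code of the path with `E i` east steps on level `i + 1`. -/
def codeOfLevels (m : ℕ) (E : ℕ → ℕ) (j : ℕ) : ℕ :=
  if j = 0 ∨ m < j then 0 else if j = 1 then E (m - j) - 1 else E (m - j)

lemma levelsOfCode_codeOfLevels {m : ℕ} {E : ℕ → ℕ} (hE : 1 ≤ E (m - 1)) {i : ℕ} (hi : i < m) :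
    levelsOfCode m (codeOfLevels m E) i = E i := by
  unfold levelsOfCode codeOfLevels
  split_ifs <;> try omega
  · rw [show m - (m - i) = m - 1 by omega, show i = m - 1 by omega]
    omega
  · rw [show m - (m - i) = i by omega]

lemma tail_codeOfLevels (m : ℕ) (E : ℕ → ℕ) (t : ℕ) :
    ∑ j ∈ Finset.Ico t (m + 1), codeOfLevels m E j =
      codeOfLevels m E t + ∑ j ∈ Finset.Ico (t + 1) (m + 1), codeOfLevels m E j := by
  rcases Nat.lt_or_ge t (m + 1) with h | h
  · rw [Finset.sum_eq_sum_Ico_succ_bot h]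
  · rw [Finset.Ico_eq_empty (by omega), Finset.Ico_eq_empty (by omega)]
    rw [codeOfLevels, if_pos (by omega), Finset.sum_empty, Nat.add_zero]

lemma dyckWord_eq_stairs (w : DyckWord) :
    w.toList = stairs w.semilength fun i => eastSteps w.toList (i + 1) := by
  refine eq_stairs_of_head _ fun a ha => ?_
  have h1 := w.count_D_le_count_U 1
  cases hw : w.toList with
  | nil => simp [hw] at ha
  | cons b v =>
    rw [hw] at ha h1
    cases b <;> simp_all

lemma exists_isPairCode {m : ℕ} (hm : 1 ≤ m) (w : DyckPair m) :
    ∃ p q, IsPairCode m p q ∧ w.1.1.toList = ofCode m p ∧ w.1.2.toList = ofCode m q := by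
  obtain ⟨⟨P, Q⟩, hP, hQ, hPQ⟩ := w
  simp only at hP hQ hPQ ⊢
  have h1 : ∀ P : DyckWord, P.semilength = m → ∃ E : ℕ → ℕ, P.toList = stairs m E ∧
      (∑ i ∈ Finset.range m, E i = m) ∧ (∀ y < m, ∑ i ∈ Finset.range y, E i ≤ y) ∧
      1 ≤ E (m - 1) := by
    intro P hP
    have h := dyckWord_eq_stairs P
    rw [hP] at h
    have hsum : ∑ i ∈ Finset.range m, eastSteps P.toList (i + 1) = m := by
      have h2 := P.count_U_eq_count_D
      have h3 := count_D_stairs m fun i => eastSteps P.toList (i + 1)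
      rw [← h, ← h2] at h3
      exact h3.symm.trans hP
    have hle := (isDyck_stairs hsum).1 (by rw [← h]; exact P.count_D_le_count_U)
    refine ⟨_, h, hsum, hle, ?_⟩
    have h4 := hle (m - 1) (by omega)
    obtain ⟨k, rfl⟩ : ∃ k, m = k + 1 := ⟨m - 1, by omega⟩
    rw [Finset.sum_range_succ] at hsum
    simp only [Nat.add_sub_cancel] at h4 ⊢
    omega
  obtain ⟨E, hPE, hE, hEle, hE1⟩ := h1 P hP
  obtain ⟨F, hQF, hF, hFle, hF1⟩ := h1 Q hQ
  rw [hPE, hQF, neverBelow_stairs] at hPQ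
  have hz : ∀ G : ℕ → ℕ, ∀ t, m < t → ∑ j ∈ Finset.Ico t (m + 1), codeOfLevels m G j = 0 := by
    intro G t ht
    rw [Finset.Ico_eq_empty (by omega), Finset.sum_empty]
  have htail : ∀ G : ℕ → ℕ, 1 ≤ G (m - 1) → ∀ t, 2 ≤ t → t ≤ m →
      ∑ j ∈ Finset.Ico t (m + 1), codeOfLevels m G j = ∑ i ∈ Finset.range (m + 1 - t), G i := by
    intro G hG t ht htm
    have := sum_levelsOfCode (m := m) (tail_codeOfLevels m G) (hz G _ (by omega))
      (y := m + 1 - t) (by omega)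
    rw [show m + 1 - (m + 1 - t) = t by omega] at this
    rw [← this]
    refine Finset.sum_congr rfl fun i hi => ?_
    have := Finset.mem_range.1 hi
    exact levelsOfCode_codeOfLevels hG (by omega)
  have htail1 : ∀ G : ℕ → ℕ, 1 ≤ G (m - 1) → ∑ i ∈ Finset.range m, G i = m →
      ∑ j ∈ Finset.Ico 1 (m + 1), codeOfLevels m G j + 1 = m := by
    intro G hG hsum
    rw [← sum_levelsOfCode_self (m := m) hm (tail_codeOfLevels m G) (hz G _ (by omega))]
    refine Eq.trans ?_ hsum
    refine Finset.sum_congr rfl fun i hi => ?_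
    exact levelsOfCode_codeOfLevels hG (Finset.mem_range.1 hi)
  refine ⟨codeOfLevels m E, codeOfLevels m F, ⟨hm, by simp [codeOfLevels], by simp [codeOfLevels],
    _, _, tail_codeOfLevels m E, tail_codeOfLevels m F, fun t ht => ⟨hz E t ht, hz F t ht⟩,
    htail1 E hE1 hE, htail1 F hF1 hF, fun t ht htm => ?_⟩, ?_, ?_⟩
  · rw [htail E hE1 t ht htm, htail F hF1 t ht htm]
    have := hPQ (m + 1 - t) (by omega)
    have := hFle (m + 1 - t) (by omega)
    omega
  · rw [ofCode_eq_stairs hm, hPE]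
    exact stairs_congr fun i hi => (levelsOfCode_codeOfLevels hE1 hi).symm
  · rw [ofCode_eq_stairs hm, hQF]
    exact stairs_congr fun i hi => (levelsOfCode_codeOfLevels hF1 hi).symm

/-! ### The parent rule for codes -/

/-- `s` is the split index of the codes `p` and `q`. -/
def IsSplit (p q : ℕ → ℕ) (s : ℕ) : Prop :=
  2 ≤ s ∧ (p s = 0 ∨ q s = 0) ∧ ∀ j, 2 ≤ j → j < s → 0 < p j ∧ 0 < q j

lemma isSplit_iff {p q : ℕ → ℕ} {s : ℕ} (h : ∃ j, 2 ≤ j ∧ p j * q j = 0) :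
    IsSplit p q s ↔ splitIndex p q = s := by
  have hmem : splitIndex p q ∈ {j | 2 ≤ j ∧ p j * q j = 0} := Nat.sInf_mem h
  have hmin : ∀ j, 2 ≤ j → j < splitIndex p q → 0 < p j ∧ 0 < q j := by
    intro j hj hlt
    have := Nat.notMem_of_lt_sInf hlt
    simp only [Set.mem_ofPred_eq, not_and, mul_eq_zero, not_or] at this
    have := this hj
    omega
  constructor
  · rintro ⟨h2, hs, hlt⟩
    rcases Nat.lt_trichotomy (splitIndex p q) s with h' | h' | h'
    · have := hlt _ hmem.1 h'
      have := mul_eq_zero.1 hmem.2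
      omega
    · exact h'
    · have := hmin s h2 h'
      omega
  · rintro rfl
    exact ⟨hmem.1, mul_eq_zero.1 hmem.2, hmin⟩

lemma IsPairCode.exists_split {m : ℕ} {p q : ℕ → ℕ} (h : IsPairCode m p q) :
    ∃ s, IsSplit p q s ∧ s ≤ m + 1 := by
  have hz : p (m + 1) * q (m + 1) = 0 := by rw [(h.support (Nat.lt_succ_self m)).1, zero_mul]
  have hm := h.1
  have hex : ∃ j, 2 ≤ j ∧ p j * q j = 0 := ⟨m + 1, by omega, hz⟩
  exact ⟨_, (isSplit_iff hex).2 rfl, Nat.sInf_le ⟨by omega, hz⟩⟩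

lemma IsSplit.splitIndex_eq {p q : ℕ → ℕ} {s : ℕ} (h : IsSplit p q s) : splitIndex p q = s :=
  (isSplit_iff ⟨s, h.1, mul_eq_zero.2 h.2.1⟩).1 h

lemma IsSplit.unique {p q : ℕ → ℕ} {s t : ℕ} (h : IsSplit p q s) (h' : IsSplit p q t) : s = t :=
  h.splitIndex_eq.symm.trans h'.splitIndex_eq

/-- The subtractions of `1` in the parent rule do not truncate. This is clear for `3 ≤ s`; for
`s = 2` it holds since `p_1 = 0` would make `p_2` and `q_2` positive. -/
lemma IsPairCode.pos_of_split {m s : ℕ} {p q : ℕ → ℕ} (h : IsPairCode m p q) (hm : 2 ≤ m)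
    (hs : IsSplit p q s) : 0 < p (s - 1) ∧ 0 < q (s - 1) + q s := by
  obtain ⟨-, h0, h0', A, B, hA, hB, hz, hA1, hB1, hAB⟩ := h
  obtain ⟨h2, hps, hlt⟩ := hs
  rcases Nat.lt_or_ge 2 s with h3 | h3
  · have := hlt (s - 1) (by omega) (by omega)
    omega
  · obtain rfl : s = 2 := by omega
    have a1 := hA 1
    have a2 := hA 2
    have b1 := hB 1
    have b2 := hB 2
    have c2 := hAB 2 le_rfl hm
    have c3 : A 3 ≤ B 3 ∧ B 3 + 2 ≤ m := by
      rcases Nat.lt_or_ge m 3 with h' | h'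
      · have := hz 3 (by omega)
        omega
      · have := hAB 3 (by omega) h'
        omega
    norm_num at a1 a2 b1 b2 ⊢
    omega

lemma IsPairCode.parent {m s : ℕ} {p q : ℕ → ℕ} (h : IsPairCode (m + 1) p q) (hm : 1 ≤ m)
    (hs : IsSplit p q s) : IsPairCode m (parentUpper s p) (parentLower s q) := by
  have hpos := h.pos_of_split (by omega) hs
  have hsm : s ≤ m + 2 := by
    obtain ⟨t, ht, htm⟩ := h.exists_split
    rw [hs.unique ht]
    omega
  obtain ⟨-, h0, h0', A, B, hA, hB, hz, hA1, hB1, hAB⟩ := h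
  obtain ⟨h2, hps, hlt⟩ := hs
  have hanti : Antitone A := antitone_nat_of_succ_le fun t => by have := hA t; omega
  have hanti' : Antitone B := antitone_nat_of_succ_le fun t => by have := hB t; omega
  obtain ⟨s, rfl⟩ : ∃ u, s = u + 1 := ⟨s - 1, by omega⟩
  have aA := hA s
  have aA' := hA (s + 1)
  have aB := hB s
  have aB' := hB (s + 1)
  rw [Nat.add_sub_cancel] at hpos
  have hge : ∀ t, t < s + 1 → 1 ≤ A t ∧ 1 ≤ B t := by
    intro t ht
    have := hanti (show t ≤ s by omega)
    have := hanti' (show t ≤ s by omega)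
    omega
  have bA := hA (m + 1)
  have bB := hB (m + 1)
  have bAB := hAB (m + 1) (by omega) (by omega)
  have hz' := hz (m + 1 + 1) (by omega)
  refine ⟨hm, ?_, ?_, fun t => if t < s + 1 then A t - 1 else if t = s + 1 then A t else A (t + 1),
    fun t => if t < s + 1 then B t - 1 else B (t + 1), ?_, ?_, ?_, ?_, ?_, ?_⟩
  · unfold parentUpper
    rw [if_pos (by omega), h0]
  · unfold parentLower
    rw [if_pos (by omega), h0']
  · intro t
    have a := hA t
    have b := hA (t + 1)
    unfold parentUpper
    dsimp only
    rcases lt_trichotomy t s with h' | rfl | h'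
    · have := hge t (by omega)
      have := hge (t + 1) (by omega)
      simp only [show t < s + 1 by omega, show t + 1 < s + 1 by omega, if_true]
      omega
    · simp only [lt_irrefl, if_false, if_true, Nat.lt_succ_self]
      omega
    · rcases Nat.lt_or_ge (s + 1) t with h'' | h''
      · simp only [show ¬ t < s + 1 by omega, show ¬ t + 1 < s + 1 by omega, if_false,
          show ¬ t = s + 1 by omega, show ¬ t + 1 = s + 1 by omega]
        exact b
      · obtain rfl : t = s + 1 := by omega
        have := hA (s + 1 + 1)
        simp only [show ¬ s + 1 + 1 < s + 1 by omega, lt_irrefl, if_false,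
          show ¬ s + 1 + 1 = s + 1 by omega, if_true]
        omega
  · intro t
    have a := hB t
    have b := hB (t + 1)
    unfold parentLower
    dsimp only
    rcases lt_trichotomy t s with h' | rfl | h'
    · have := hge t (by omega)
      have := hge (t + 1) (by omega)
      simp only [show t < s + 1 by omega, show t + 1 < s + 1 by omega, if_true]
      omega
    · simp only [lt_irrefl, if_false, if_true, Nat.lt_succ_self]
      omega
    · simp only [show ¬ t < s + 1 by omega, show ¬ t + 1 < s + 1 by omega, if_false,
          show ¬ t + 1 = s + 1 by omega]
      exact b
  · intro t ht
    dsimp only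
    rcases Nat.eq_or_lt_of_le (show m + 1 ≤ t from ht) with rfl | ht'
    · split_ifs with h1 h2
      · omega
      · rw [← h2] at hps
        omega
      · omega
    · have := hz t (by omega)
      have := hz (t + 1) (by omega)
      split_ifs <;> omega
  · dsimp only
    rw [if_pos (by omega)]
    omega
  · dsimp only
    rw [if_pos (by omega)]
    omega
  · intro t ht htm
    have a := hAB t ht (by omega)
    have b := hAB (t + 1) (by omega) (by omega)
    dsimp only
    split_ifs with h1 h2
    · have := hge t h1
      omega
    · subst h2
      omega
    · omega

/-- The converse of `IsPairCode.parent`: the parent rule can be reversed for each split index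
`s` and each way to divide the merged entries that obeys the stated positivity conditions. -/
lemma IsPairCode.of_parent {m s : ℕ} {p q : ℕ → ℕ} (h0 : p 0 = 0) (h0' : q 0 = 0) (hs2 : 2 ≤ s)
    (hsm : s ≤ m + 2) (hps : p s = 0 ∨ q s = 0) (hp1 : 0 < p (s - 1))
    (hq1 : 0 < q (s - 1) + q s) (hq2 : 3 ≤ s → 0 < q (s - 1))
    (h : IsPairCode m (parentUpper s p) (parentLower s q)) : IsPairCode (m + 1) p q := by
  obtain ⟨hm, -, -, A, B, hA, hB, hz, hA1, hB1, hAB⟩ := h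
  obtain ⟨s, rfl⟩ : ∃ u, s = u + 1 := ⟨s - 1, by omega⟩
  rw [Nat.add_sub_cancel] at hp1 hq1 hq2
  -- the parent rule, read entry by entry
  have pA1 : ∀ t, t < s → A t = p t + A (t + 1) ∧ B t = q t + B (t + 1) := fun t ht => by
    rw [hA t, hB t, parentUpper, parentLower, if_pos (by omega), if_pos (by omega)]
    exact ⟨rfl, rfl⟩
  have pA2 : A s + 1 = p s + A (s + 1) ∧ B s + 1 = q s + q (s + 1) + B (s + 1) := by
    rw [hA s, hB s]
    simp only [parentUpper, parentLower, lt_irrefl, if_false, if_true]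
    omega
  have pA3 : A (s + 1) = p (s + 1) + p (s + 1 + 1) + A (s + 1 + 1) := by
    rw [hA (s + 1), parentUpper, if_neg (by omega), if_neg (by omega), if_pos rfl]
  have pA4 : ∀ t, s + 1 < t → A t = p (t + 1) + A (t + 1) := fun t ht => by
    rw [hA t, parentUpper, if_neg (by omega), if_neg (by omega), if_neg (by omega)]
  have pB4 : ∀ t, s < t → B t = q (t + 1) + B (t + 1) := fun t ht => by
    rw [hB t, parentLower, if_neg (by omega), if_neg (by omega)]
  refine ⟨by omega, h0, h0', fun t => if t < s + 1 then A t + 1 else if t = s + 1 then A t else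
    if t = s + 2 then p t + A t else A (t - 1), fun t => if t < s + 1 then B t + 1 else
    if t = s + 1 then q t + B t else B (t - 1), ?_, ?_, ?_, ?_, ?_, ?_⟩
  · intro t
    dsimp only
    rcases lt_trichotomy t s with h' | rfl | h'
    · have := pA1 t h'
      simp only [show t < s + 1 by omega, show t + 1 < s + 1 by omega, if_true]
      omega
    · simp only [lt_irrefl, if_false, if_true, Nat.lt_succ_self]
      omega
    · obtain ⟨u, rfl⟩ : ∃ u, t = u + 1 := ⟨t - 1, by omega⟩
      rcases lt_trichotomy u (s + 1) with h'' | rfl | h''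
      · obtain rfl : u = s := by omega
        simp only [show ¬ u + 1 + 1 < u + 1 by omega, lt_irrefl, if_false,
          show ¬ u + 1 + 1 = u + 1 by omega, if_true]
        omega
      · simp only [show ¬ s + 1 + 1 < s + 1 by omega, show ¬ s + 1 + 1 + 1 < s + 1 by omega,
          if_false, show ¬ s + 1 + 1 = s + 1 by omega, show ¬ s + 1 + 1 + 1 = s + 1 by omega,
          show ¬ s + 1 + 1 + 1 = s + 2 by omega, if_true, Nat.add_sub_cancel]
      · have := pA4 u h''
        simp only [show ¬ u + 1 < s + 1 by omega, show ¬ u + 1 + 1 < s + 1 by omega,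
          if_false, show ¬ u + 1 = s + 1 by omega, show ¬ u + 1 + 1 = s + 1 by omega,
          show ¬ u + 1 = s + 2 by omega, show ¬ u + 1 + 1 = s + 2 by omega, Nat.add_sub_cancel]
        exact this
  · intro t
    dsimp only
    rcases lt_trichotomy t s with h' | rfl | h'
    · have := pA1 t h'
      simp only [show t < s + 1 by omega, show t + 1 < s + 1 by omega, if_true]
      omega
    · simp only [lt_irrefl, if_false, if_true, Nat.lt_succ_self]
      omega
    · obtain ⟨u, rfl⟩ : ∃ u, t = u + 1 := ⟨t - 1, by omega⟩
      rcases Nat.lt_or_ge s u with h'' | h''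
      · have := pB4 u h''
        simp only [show ¬ u + 1 < s + 1 by omega, show ¬ u + 1 + 1 < s + 1 by omega,
          if_false, show ¬ u + 1 = s + 1 by omega, show ¬ u + 1 + 1 = s + 1 by omega,
          Nat.add_sub_cancel]
        exact this
      · obtain rfl : u = s := by omega
        simp only [show ¬ u + 1 + 1 < u + 1 by omega, lt_irrefl, if_false,
          show ¬ u + 1 + 1 = u + 1 by omega, if_true, Nat.add_sub_cancel]
  · intro t ht
    have z1 := hz t (by omega)
    have z2 := hz (t - 1) (by omega)
    dsimp only
    rcases lt_trichotomy t (s + 1) with h' | rfl | h'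
    · omega
    · rw [Nat.add_sub_cancel] at z2
      simp only [lt_irrefl, if_false, if_true]
      omega
    · simp only [show ¬ t < s + 1 by omega, show ¬ t = s + 1 by omega, if_false]
      refine ⟨?_, z2.2⟩
      split_ifs with h''
      · subst h''
        rw [show s + 2 - 1 = s + 1 by omega] at z2
        rw [show s + 2 = s + 1 + 1 by omega] at *
        omega
      · exact z2.1
  · dsimp only
    rw [if_pos (by omega)]
    omega
  · dsimp only
    rw [if_pos (by omega)]
    omega
  · intro t ht htm
    have key : ∀ u, 2 ≤ u → A u ≤ B u ∧ (u ≤ m + 1 → B u + u ≤ m + 1) := by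
      intro u hu
      rcases Nat.lt_or_ge m u with h' | h'
      · have := hz u h'
        omega
      · have := hAB u hu h'
        omega
    dsimp only
    have k1 := key t ht
    rcases lt_trichotomy t (s + 1) with h' | rfl | h'
    · simp only [h', if_true]
      omega
    · simp only [lt_irrefl, if_false, if_true]
      refine ⟨by omega, ?_⟩
      rcases Nat.lt_or_ge 2 (s + 1) with h3 | h3
      · have := hq2 h3
        have := key s (by omega)
        omega
      · obtain rfl : s = 1 := by omega
        omega
    · have k2 := key (t - 1) (by omega)
      simp only [show ¬ t < s + 1 by omega, show ¬ t = s + 1 by omega, if_false]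
      refine ⟨?_, by omega⟩
      split_ifs with h''
      · subst h''
        rw [show s + 2 - 1 = s + 1 by omega] at *
        rw [show s + 2 = s + 1 + 1 by omega] at *
        omega
      · exact k2.1

/-- A pair of codes is determined by its parent, its split index `s` and `p_s + q_(s-1)`. -/
lemma eq_of_parent_eq {s : ℕ} {p q p' q' : ℕ → ℕ} (hs : 2 ≤ s) (hps : p s = 0 ∨ q s = 0)
    (hps' : p' s = 0 ∨ q' s = 0) (hp : 0 < p (s - 1)) (hp' : 0 < p' (s - 1))
    (hq : 0 < q (s - 1) + q s) (hq' : 0 < q' (s - 1) + q' s)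
    (hu : parentUpper s p = parentUpper s p') (hl : parentLower s q = parentLower s q')
    (hsum : p s + q (s - 1) = p' s + q' (s - 1)) : p = p' ∧ q = q' := by
  obtain ⟨s, rfl⟩ : ∃ u, s = u + 1 := ⟨s - 1, by omega⟩
  rw [Nat.add_sub_cancel] at *
  have u := fun j => congrFun hu j
  have l := fun j => congrFun hl j
  simp only [parentUpper, parentLower] at u l
  have u1 := u s
  have u2 := u (s + 1)
  have l1 := l s
  simp only [lt_irrefl, if_false, if_true, show ¬ s + 1 + 1 < s + 1 by omega,
    show ¬ s + 1 + 1 = s + 1 by omega] at u1 u2 l1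
  have key : p s = p' s ∧ p (s + 1) = p' (s + 1) ∧ p (s + 1 + 1) = p' (s + 1 + 1) ∧
    q s = q' s ∧ q (s + 1) = q' (s + 1) := by omega
  constructor
  · funext j
    rcases lt_trichotomy j s with h | rfl | h
    · simpa [h] using u j
    · exact key.1
    · rcases Nat.lt_or_ge (s + 2) j with h' | h'
      · have := u (j - 1)
        rwa [if_neg (by omega), if_neg (by omega), if_neg (by omega), if_neg (by omega),
          if_neg (by omega), if_neg (by omega), Nat.sub_add_cancel (by omega)] at this
      · rcases Nat.lt_or_ge (s + 1) j with h'' | h''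
        · obtain rfl : j = s + 1 + 1 := by omega
          exact key.2.2.1
        · obtain rfl : j = s + 1 := by omega
          exact key.2.1
  · funext j
    rcases lt_trichotomy j s with h | rfl | h
    · simpa [h] using l j
    · exact key.2.2.2.1
    · rcases Nat.lt_or_ge (s + 1) j with h' | h'
      · have := l (j - 1)
        rwa [if_neg (by omega), if_neg (by omega), if_neg (by omega), if_neg (by omega),
          Nat.sub_add_cancel (by omega)] at this
      · obtain rfl : j = s + 1 := by omega
        exact key.2.2.2.2

/-! ### Two-triangulations in coordinates -/

lemma mem_diagonals {n a b : ℕ} :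
    (a, b) ∈ diagonals n ↔ 1 ≤ a ∧ a + 2 ≤ b ∧ b ≤ n ∧ ¬(a = 1 ∧ b = n) := by
  simp only [diagonals, Finset.mem_filter, Finset.mem_product, Finset.mem_Icc]
  omega

lemma mem_diagram {n a b : ℕ} {T : Finset (ℕ × ℕ)} (hT : T ⊆ diagonals n) :
    (a, b) ∈ diagram n T ↔ (a, b) ∈ T ∧ a + 3 ≤ b ∧ b + 3 ≤ a + n := by
  have := @hT (a, b)
  simp only [diagram, shape, Finset.mem_inter, Finset.mem_filter]
  tauto

/-- `2`-triangulations, with the condition on crossings written out in coordinates: there is no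
`3`-crossing, and each missing diagonal would create one. -/
structure Tri (n : ℕ) (T : Finset (ℕ × ℕ)) : Prop where
  sub : T ⊆ diagonals n
  free : ∀ a₁ a₂ a₃ b₁ b₂ b₃, (a₁, b₁) ∈ T → (a₂, b₂) ∈ T → (a₃, b₃) ∈ T →
    a₁ < a₂ → a₂ < a₃ → a₃ < b₁ → b₁ < b₂ → b₂ < b₃ → False
  sat : ∀ a b, (a, b) ∈ diagonals n → (a, b) ∉ T → ∃ c d e f, (c, d) ∈ T ∧ (e, f) ∈ T ∧
    (a < c ∧ c < e ∧ e < b ∧ b < d ∧ d < f ∨ c < a ∧ a < e ∧ e < d ∧ d < b ∧ b < f ∨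
      c < e ∧ e < a ∧ a < d ∧ d < f ∧ f < b)

lemma hasCrossing_three_iff {T : Finset (ℕ × ℕ)} :
    HasCrossing 3 T ↔ ∃ a₁ a₂ a₃ b₁ b₂ b₃, (a₁, b₁) ∈ T ∧ (a₂, b₂) ∈ T ∧ (a₃, b₃) ∈ T ∧
      a₁ < a₂ ∧ a₂ < a₃ ∧ a₃ < b₁ ∧ b₁ < b₂ ∧ b₂ < b₃ := by
  constructor
  · rintro ⟨S, hST, hcard, hS⟩
    obtain ⟨⟨a, b⟩, ⟨c, d⟩, ⟨e, f⟩, h1, h2, h3, rfl⟩ := Finset.card_eq_three.1 hcard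
    have c1 : Cross (a, b) (c, d) := hS (by simp) (by simp) h1
    have c2 : Cross (a, b) (e, f) := hS (by simp) (by simp) h2
    have c3 : Cross (c, d) (e, f) := hS (by simp) (by simp) h3
    have m1 : (a, b) ∈ T := hST (by simp)
    have m2 : (c, d) ∈ T := hST (by simp)
    have m3 : (e, f) ∈ T := hST (by simp)
    simp only [Cross] at c1 c2 c3
    rcases lt_or_ge a c with hac | hac <;> rcases lt_or_ge a e with hae | hae <;>
      rcases lt_or_ge c e with hce | hce
    · exact ⟨a, c, e, b, d, f, m1, m2, m3, by omega⟩
    · exact ⟨a, e, c, b, f, d, m1, m3, m2, by omega⟩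
    · omega
    · exact ⟨e, a, c, f, b, d, m3, m1, m2, by omega⟩
    · exact ⟨c, a, e, d, b, f, m2, m1, m3, by omega⟩
    · omega
    · exact ⟨c, e, a, d, f, b, m2, m3, m1, by omega⟩
    · exact ⟨e, c, a, f, d, b, m3, m2, m1, by omega⟩
  · rintro ⟨a₁, a₂, a₃, b₁, b₂, b₃, m1, m2, m3, h⟩
    refine ⟨{(a₁, b₁), (a₂, b₂), (a₃, b₃)}, ?_, ?_, ?_⟩
    · intro x hx
      simp only [Finset.mem_insert, Finset.mem_singleton] at hx
      rcases hx with rfl | rfl | rfl <;> assumption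
    · rw [Finset.card_eq_three]
      refine ⟨_, _, _, ?_, ?_, ?_, rfl⟩ <;> simp only [ne_eq, Prod.mk.injEq] <;> omega
    · intro x hx y hy hxy
      simp only [Finset.coe_insert, Finset.coe_singleton, Set.mem_insert_iff,
        Set.mem_singleton_iff] at hx hy
      rcases hx with rfl | rfl | rfl <;> rcases hy with rfl | rfl | rfl <;>
        first
          | exact absurd rfl hxy
          | (simp only [Cross]; omega)

lemma isTriangulation_iff {n : ℕ} {T : Finset (ℕ × ℕ)} : IsTriangulation 2 n T ↔ Tri n T := by
  unfold IsTriangulation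
  constructor
  · rintro ⟨⟨hsub, hfree⟩, hmax⟩
    refine ⟨hsub, ?_, ?_⟩
    · intro a₁ a₂ a₃ b₁ b₂ b₃ m1 m2 m3 h1 h2 h3 h4 h5
      exact hfree (hasCrossing_three_iff.2
        ⟨a₁, a₂, a₃, b₁, b₂, b₃, m1, m2, m3, h1, h2, h3, h4, h5⟩)
    · intro a b hd hn
      have hc : HasCrossing 3 (insert (a, b) T) := by
        by_contra hc
        have h1 : insert (a, b) T ⊆ diagonals n := Finset.insert_subset hd hsub
        exact hn (hmax ⟨h1, hc⟩ (Finset.subset_insert _ _) (Finset.mem_insert_self _ _))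
      obtain ⟨a₁, a₂, a₃, b₁, b₂, b₃, m1, m2, m3, h⟩ := hasCrossing_three_iff.1 hc
      have hf : ¬((a₁, b₁) ∈ T ∧ (a₂, b₂) ∈ T ∧ (a₃, b₃) ∈ T) := fun hm =>
        hfree (hasCrossing_three_iff.2 ⟨a₁, a₂, a₃, b₁, b₂, b₃, hm.1, hm.2.1, hm.2.2, h⟩)
      simp only [Finset.mem_insert, Prod.mk.injEq] at m1 m2 m3
      rcases m1 with ⟨rfl, rfl⟩ | m1
      · exact ⟨a₂, b₂, a₃, b₃, m2.resolve_left (by omega), m3.resolve_left (by omega), by omega⟩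
      rcases m2 with ⟨rfl, rfl⟩ | m2
      · exact ⟨a₁, b₁, a₃, b₃, m1, m3.resolve_left (by omega), by omega⟩
      rcases m3 with ⟨rfl, rfl⟩ | m3
      · exact ⟨a₁, b₁, a₂, b₂, m1, m2, by omega⟩
      · exact absurd ⟨m1, m2, m3⟩ hf
  · intro h
    refine ⟨⟨h.sub, fun hc => ?_⟩, ?_⟩
    · obtain ⟨a₁, a₂, a₃, b₁, b₂, b₃, m1, m2, m3, h1, h2, h3, h4, h5⟩ :=
        hasCrossing_three_iff.1 hc
      exact h.free _ _ _ _ _ _ m1 m2 m3 h1 h2 h3 h4 h5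
    · rintro T' ⟨hsub, hfree⟩ hle ⟨a, b⟩ hab
      by_contra hn
      obtain ⟨c, d, e, f, m1, m2, hh⟩ := h.sat a b (hsub hab) hn
      refine hfree (hasCrossing_three_iff.2 ?_)
      have m1 := hle m1
      have m2 := hle m2
      rcases hh with hh | hh | hh
      · exact ⟨a, c, e, b, d, f, hab, m1, m2, hh⟩
      · exact ⟨c, a, e, d, b, f, m1, hab, m2, hh⟩
      · exact ⟨c, e, a, d, f, b, m1, m2, hab, hh⟩

namespace Tri

variable {n : ℕ} {T : Finset (ℕ × ℕ)}

lemma bounds (h : Tri n T) {a b : ℕ} (hab : (a, b) ∈ T) :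
    1 ≤ a ∧ a + 2 ≤ b ∧ b ≤ n ∧ ¬(a = 1 ∧ b = n) := mem_diagonals.1 (h.sub hab)

/-- A trivial diagonal belongs to every `2`-triangulation, as it takes part in no `3`-crossing. -/
lemma trivial_mem (h : Tri n T) {a b : ℕ} (hab : (a, b) ∈ diagonals n)
    (ht : b = a + 2 ∨ a + n ≤ b + 2) : (a, b) ∈ T := by
  by_contra hn
  obtain ⟨c, d, e, f, m1, m2, hh⟩ := h.sat a b hab hn
  have := h.bounds m1
  have := h.bounds m2
  have := mem_diagonals.1 hab
  omega

lemma mem_iff (h : Tri n T) {a b : ℕ} : (a, b) ∈ T ↔ (a, b) ∈ diagonals n ∧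
    ((a, b) ∈ diagram n T ∨ b = a + 2 ∨ a + n ≤ b + 2) := by
  rw [mem_diagram h.sub]
  constructor
  · intro hab
    have := h.bounds hab
    refine ⟨h.sub hab, ?_⟩
    by_cases hc : a + 3 ≤ b ∧ b + 3 ≤ a + n
    · exact Or.inl ⟨hab, hc⟩
    · exact Or.inr (by omega)
  · rintro ⟨hd, hh | hh⟩
    · exact hh.1
    · exact h.trivial_mem hd hh

/-- A `2`-triangulation is determined by its diagram. -/
lemma eq_of_diagram_eq {T' : Finset (ℕ × ℕ)} (h : Tri n T) (h' : Tri n T')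
    (hD : diagram n T = diagram n T') : T = T' := by
  ext ⟨a, b⟩
  rw [h.mem_iff, h'.mem_iff, hD]

/-- Below each nontrivial diagonal there is a shortest one, of length `3`. -/
lemma exists_short (h : Tri n T) : ∀ k a, (a, a + 3 + k) ∈ T → ∃ c, a ≤ c ∧ (c, c + 3) ∈ T := by
  intro k
  induction k using Nat.strong_induction_on with
  | _ k ih =>
    intro a hab
    rcases Nat.eq_zero_or_pos k with rfl | hk
    · exact ⟨a, le_rfl, hab⟩
    have hb := h.bounds hab
    by_cases hm : (a, a + 3 + (k - 1)) ∈ T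
    · exact ih (k - 1) (by omega) a hm
    obtain ⟨c, d, e, f, m1, m2, hh⟩ :=
      h.sat a (a + 3 + (k - 1)) (mem_diagonals.2 (by omega)) hm
    -- one of the two diagonals ends at `a + 3 + k`, since otherwise both cross `(a, a + 3 + k)`
    have key : ∀ x y, (x, y) ∈ T → a < x → x + 3 ≤ y → y = a + 3 + k →
        ∃ c, a ≤ c ∧ (c, c + 3) ∈ T := by
      intro x y hxy hx hxy3 hy
      obtain ⟨l, rfl⟩ : ∃ l, y = x + 3 + l := ⟨y - (x + 3), by omega⟩
      obtain ⟨c, hc, hcT⟩ := ih l (by omega) x hxy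
      exact ⟨c, by omega, hcT⟩
    have b1 := h.bounds m1
    have b2 := h.bounds m2
    rcases hh with hh | hh | hh
    · rcases Nat.eq_or_lt_of_le (show a + 3 + k ≤ d by omega) with h' | h'
      · exact key c d m1 hh.1 (by omega) h'.symm
      · exact (h.free _ _ _ _ _ _ hab m1 m2 (by omega) (by omega) (by omega) (by omega)
          (by omega)).elim
    · rcases Nat.eq_or_lt_of_le (show a + 3 + k ≤ f by omega) with h' | h'
      · exact key e f m2 (by omega) (by omega) h'.symm
      · exact (h.free _ _ _ _ _ _ m1 hab m2 (by omega) (by omega) (by omega) (by omega)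
          (by omega)).elim
    · exact (h.free _ _ _ _ _ _ m1 m2 hab (by omega) (by omega) (by omega) (by omega)
          (by omega)).elim

end Tri

/-- The local structure of a `2`-triangulation at the side `(r + 1, r + 2)` that is contracted:
the vertices `j`, `r`, `r + 1`, `r + 2`, `r + 3` form a pentagram, and all diagonals in rows below
the corner are trivial. -/
structure Star (n : ℕ) (T : Finset (ℕ × ℕ)) (r j : ℕ) : Prop where
  one_le : 1 ≤ j
  lt : j < r
  le : r + 3 ≤ n
  corner_mem : (r, r + 3) ∈ T
  left_mem : (j, r + 1) ∈ T
  right_mem : (j, r + 2) ∈ T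
  row : ∀ a b, (a, b) ∈ T → r < a → b = a + 2

lemma le_corner {n r : ℕ} {D : Finset (ℕ × ℕ)} (h1 : 1 ≤ r) (h2 : r + 3 ≤ n)
    (h : (r, r + 3) ∈ D) : r ≤ corner n D :=
  Finset.le_sup (f := id) (by simp only [Finset.mem_filter, Finset.mem_Icc]; exact ⟨by omega, h⟩)

lemma corner_spec {n : ℕ} {D : Finset (ℕ × ℕ)} (h : 0 < corner n D) :
    1 ≤ corner n D ∧ corner n D ≤ n - 3 ∧ (corner n D, corner n D + 3) ∈ D := by
  have hne : ((Finset.Icc 1 (n - 3)).filter fun a => (a, a + 3) ∈ D).Nonempty := by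
    by_contra hne
    rw [Finset.not_nonempty_iff_eq_empty] at hne
    simp [corner, hne] at h
  obtain ⟨x, hx, he⟩ := Finset.exists_mem_eq_sup _ hne id
  have he : corner n D = x := he
  simp only [Finset.mem_filter, Finset.mem_Icc] at hx
  rw [he]
  exact ⟨hx.1.1, hx.1.2, hx.2⟩

lemma Star.corner_eq {n r j : ℕ} {T : Finset (ℕ × ℕ)} (hn : 6 ≤ n) (h : Tri n T)
    (hs : Star n T r j) : corner n (diagram n T) = r := by
  have h1 := le_corner (D := diagram n T) (n := n) (r := r)
    (by have := hs.lt; omega) hs.le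
    ((mem_diagram h.sub).2 ⟨hs.corner_mem, le_rfl, by omega⟩)
  have h2 := corner_spec (n := n) (D := diagram n T) (by have := hs.lt; omega)
  by_contra hne
  have := hs.row _ _ ((mem_diagram h.sub).1 h2.2.2).1 (by omega)
  omega

namespace Tri

variable {n : ℕ} {T : Finset (ℕ × ℕ)}

/-- Rows below the corner contain trivial diagonals only. -/
lemma row_of_corner_lt (h : Tri n T) {a b : ℕ} (hab : (a, b) ∈ T)
    (ha : corner n (diagram n T) < a) (ha2 : 2 ≤ a) (hn : 6 ≤ n) : b = a + 2 := by
  have hb := h.bounds hab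
  by_contra hne
  obtain ⟨k, rfl⟩ : ∃ k, b = a + 3 + k := ⟨b - (a + 3), by omega⟩
  obtain ⟨c, hc, hcT⟩ := h.exists_short k a hab
  have hb' := h.bounds hcT
  have := le_corner (D := diagram n T) (n := n) (r := c) (by omega) (by omega)
    ((mem_diagram h.sub).2 ⟨hcT, le_rfl, by omega⟩)
  omega

lemma exists_star (hn : 6 ≤ n) (h : Tri n T) : ∃ r j, Star n T r j := by
  -- a short diagonal whose first vertex is not `1`
  obtain ⟨c, hc2, hcT⟩ : ∃ c, 2 ≤ c ∧ (c, c + 3) ∈ T := by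
    by_contra! hno
    have hrow : ∀ a b, (a, b) ∈ T → 2 ≤ a → b = a + 2 := by
      intro a b hab ha
      have hb := h.bounds hab
      by_contra hne
      obtain ⟨k, rfl⟩ : ∃ k, b = a + 3 + k := ⟨b - (a + 3), by omega⟩
      obtain ⟨c, hc, hcT⟩ := h.exists_short k a hab
      exact hno c (by omega) hcT
    by_cases hm : (2, 2 + 3) ∈ T
    · exact hno 2 le_rfl hm
    · obtain ⟨c, d, e, f, m1, m2, hh⟩ := h.sat 2 (2 + 3) (mem_diagonals.2 (by omega)) hm
      have b1 := h.bounds m1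
      have b2 := h.bounds m2
      have := hrow c d m1
      have := hrow e f m2
      omega
  have hcb := h.bounds hcT
  have hle := le_corner (D := diagram n T) (n := n) (r := c) (by omega) (by omega)
    ((mem_diagram h.sub).2 ⟨hcT, le_rfl, by omega⟩)
  set r := corner n (diagram n T) with hr
  have hrm := corner_spec (n := n) (D := diagram n T) (by omega)
  rw [← hr] at hrm
  have hrT := ((mem_diagram h.sub).1 hrm.2.2).1
  have hrow : ∀ a b, (a, b) ∈ T → r < a → b = a + 2 := fun a b hab ha =>
    h.row_of_corner_lt hab ha (by omega) hn
  have hex : ∃ a, (a, r + 1) ∈ T :=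
    ⟨r - 1, h.trivial_mem (mem_diagonals.2 (by omega)) (by omega)⟩
  classical
  set j := Nat.find hex with hj
  have hjT : (j, r + 1) ∈ T := Nat.find_spec hex
  have hmin : ∀ a, (a, r + 1) ∈ T → j ≤ a := fun a ha => Nat.find_min' hex ha
  have hjb := h.bounds hjT
  refine ⟨r, j, hjb.1, by omega, by omega, hrT, hjT, ?_, hrow⟩
  -- if `(j, r + 2)` were missing, the two diagonals that complete a `3`-crossing with it would
  -- avoid `r + 1` by the choice of `j`, and hence complete a `3`-crossing with `(j, r + 1)`
  by_contra hm
  obtain ⟨c, d, e, f, m1, m2, hh⟩ := h.sat j (r + 2) (mem_diagonals.2 (by omega)) hm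
  have b1 := h.bounds m1
  have b2 := h.bounds m2
  have n1 : d = r + 1 → j ≤ c := by rintro rfl; exact hmin _ m1
  have n2 : f = r + 1 → j ≤ e := by rintro rfl; exact hmin _ m2
  have o1 := hrow c d m1
  have o2 := hrow e f m2
  rcases hh with hh | hh | hh
  · exact h.free _ _ _ _ _ _ hjT m1 m2 (by omega) (by omega) (by omega) (by omega) (by omega)
  · exact h.free _ _ _ _ _ _ m1 hjT m2 (by omega) (by omega) (by omega) (by omega) (by omega)
  · exact h.free _ _ _ _ _ _ m1 m2 hjT (by omega) (by omega) (by omega) (by omega) (by omega)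

end Tri

namespace Star

variable {n r j : ℕ} {T : Finset (ℕ × ℕ)}

/-- The neighbours of `r + 1` come weakly after `j`: otherwise there is a `3`-crossing with
`(j, r + 2)` and the corner. -/
lemma le_of_mem (hs : Star n T r j) (h : Tri n T) {a : ℕ} (ha : (a, r + 1) ∈ T) : j ≤ a := by
  by_contra hlt
  have := hs.lt
  exact h.free _ _ _ _ _ _ ha hs.right_mem hs.corner_mem (by omega) (by omega) (by omega)
    (by omega) (by omega)

lemma ge_of_mem (hs : Star n T r j) (h : Tri n T) {a : ℕ} (ha : (a, r + 2) ∈ T) :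
    a ≤ j ∨ a = r := by
  by_contra hlt
  have := hs.lt
  have := h.bounds ha
  exact h.free _ _ _ _ _ _ hs.left_mem ha hs.corner_mem (by omega) (by omega) (by omega)
    (by omega) (by omega)

end Star

/-- The contraction of the side `(r + 1, r + 2)` of the `(n + 1)`-gon, with the trivial diagonals
kept: the images of the diagonals that do not become sides. -/
def flat (n r : ℕ) (T : Finset (ℕ × ℕ)) : Finset (ℕ × ℕ) :=
  (T.image fun d => (contract r d.1, contract r d.2)) ∩ diagonals n

lemma mem_flat {n r a b : ℕ} {T : Finset (ℕ × ℕ)} : (a, b) ∈ flat n r T ↔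
    (a, b) ∈ diagonals n ∧ ∃ x y, (x, y) ∈ T ∧ contract r x = a ∧ contract r y = b := by
  simp only [flat, Finset.mem_inter, Finset.mem_image, Prod.exists, Prod.mk.injEq]
  tauto

/-- The inverse of the contraction: the vertex `r + 1` of the `n`-gon is split along the diagonal
`(j, r + 1)`, which is doubled. The neighbours `a ≥ j` of `r + 1` are joined to `r + 1`, the
neighbours `a ≤ j` to `r + 2`. -/
def inflate (n r j : ℕ) (T : Finset (ℕ × ℕ)) : Finset (ℕ × ℕ) :=
  (diagonals (n + 1)).filter fun d => (d = (r, r + 2) ∨ d = (r + 1, r + 3)) ∨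
    (contract r d.1, contract r d.2) ∈ T ∧ (d.2 = r + 1 → j ≤ d.1) ∧ (d.2 = r + 2 → d.1 ≤ j) ∧
      d.1 ≠ r + 1

lemma mem_inflate {n r j a b : ℕ} {T : Finset (ℕ × ℕ)} : (a, b) ∈ inflate n r j T ↔
    (a, b) ∈ diagonals (n + 1) ∧ ((a = r ∧ b = r + 2 ∨ a = r + 1 ∧ b = r + 3) ∨
    (contract r a, contract r b) ∈ T ∧ (b = r + 1 → j ≤ a) ∧ (b = r + 2 → a ≤ j) ∧ a ≠ r + 1) := by
  simp only [inflate, Finset.mem_filter, Prod.mk.injEq]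

/-! ### Contraction and splitting -/

lemma contract_spec (r v : ℕ) :
    v ≤ r + 1 ∧ contract r v = v ∨ r + 2 ≤ v ∧ contract r v + 1 = v := by
  unfold contract
  split_ifs <;> omega

lemma contract_mono {r x y : ℕ} (h : x ≤ y) : contract r x ≤ contract r y := by
  have := contract_spec r x
  have := contract_spec r y
  omega

lemma lt_of_contract_lt {r x y : ℕ} (h : contract r x < contract r y) : x < y := by
  by_contra! hle
  exact absurd (contract_mono (r := r) hle) (by omega)

lemma contract_lt {r x y : ℕ} (h : x < y) (hne : x = r + 1 → y ≠ r + 2) :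
    contract r x < contract r y := by
  have := contract_spec r x
  have := contract_spec r y
  omega

/-- A `3`-crossing without diagonals in row `r + 1` stays one under the contraction, unless two of
its diagonals end in `r + 1` and `r + 2`. -/
lemma contract_crossing {r a₁ a₂ a₃ b₁ b₂ b₃ : ℕ} (ha₃ : a₃ ≠ r + 1) (ha₂ : a₂ ≠ r + 1)
    (ha₁ : a₁ ≠ r + 1) (hb₁ : ¬(b₁ = r + 1 ∧ b₂ = r + 2)) (hb₂ : ¬(b₂ = r + 1 ∧ b₃ = r + 2))
    (h : a₁ < a₂ ∧ a₂ < a₃ ∧ a₃ < b₁ ∧ b₁ < b₂ ∧ b₂ < b₃) :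
    contract r a₁ < contract r a₂ ∧ contract r a₂ < contract r a₃ ∧
      contract r a₃ < contract r b₁ ∧ contract r b₁ < contract r b₂ ∧
      contract r b₂ < contract r b₃ :=
  ⟨contract_lt h.1 (by omega), contract_lt h.2.1 (by omega), contract_lt h.2.2.1 (by omega),
    contract_lt h.2.2.2.1 (by omega), contract_lt h.2.2.2.2 (by omega)⟩

section Flat

variable {n r j : ℕ} {T : Finset (ℕ × ℕ)}

lemma Star.row_flat (hs : Star (n + 1) T r j) {a b : ℕ} (hab : (a, b) ∈ flat n r T)
    (ha : r < a) : b = a + 2 := by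
  obtain ⟨hd, x, y, hxy, hx, hy⟩ := mem_flat.1 hab
  have := mem_diagonals.1 hd
  have := contract_spec r x
  have := contract_spec r y
  have := hs.row x y hxy (by omega)
  omega

/-- The diagonals of the contraction in the rows up to `r` lift to the same row. These are the only
ones that can belong to a `3`-crossing. -/
lemma exists_lift {a b : ℕ} (hab : (a, b) ∈ flat n r T) (ha : a ≤ r) :
    ∃ y, (a, y) ∈ T ∧ contract r y = b := by
  obtain ⟨hd, x, y, hxy, hx, hy⟩ := mem_flat.1 hab
  have := contract_spec r x
  obtain rfl : x = a := by omega
  exact ⟨y, hxy, hy⟩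

lemma contract_mem_flat (h : Tri (n + 1) T) {a b : ℕ} (hab : (a, b) ∈ T)
    (hlt : contract r a + 2 ≤ contract r b) (hn : ¬(contract r a = 1 ∧ contract r b = n))
    (hr : r + 2 ≤ n) :
    (contract r a, contract r b) ∈ flat n r T := by
  have := h.bounds hab
  have := contract_spec r a
  have := contract_spec r b
  exact mem_flat.2 ⟨mem_diagonals.2 (by omega), a, b, hab, rfl, rfl⟩

/-- The contraction of a `2`-triangulation at its star is a `2`-triangulation: `3`-crossings lift,
and so do missing diagonals, those at `r + 1` on the side of `j` that makes the lift missing. -/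
lemma Tri.flat (h : Tri (n + 1) T) (hs : Star (n + 1) T r j) : Tri n (flat n r T) := by
  have hj := hs.lt
  have hr := hs.le
  have hj1 := hs.one_le
  refine ⟨fun x hx => (mem_flat.1 (show (x.1, x.2) ∈ _ from hx)).1, ?_, ?_⟩
  · intro a₁ a₂ a₃ b₁ b₂ b₃ m1 m2 m3 h1 h2 h3 h4 h5
    have h6 : a₃ ≤ r := by
      by_contra hlt
      have := hs.row_flat m3 (by omega)
      omega
    obtain ⟨y1, l1, rfl⟩ := exists_lift m1 (by omega)
    obtain ⟨y2, l2, rfl⟩ := exists_lift m2 (by omega)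
    obtain ⟨y3, l3, rfl⟩ := exists_lift m3 (by omega)
    have := contract_spec r y1
    exact h.free _ _ _ _ _ _ l1 l2 l3 h1 h2 (by omega) (lt_of_contract_lt h4)
      (lt_of_contract_lt h5)
  · intro a b hd hn
    have hb := mem_diagonals.1 hd
    obtain ⟨x, hx, hx'⟩ : ∃ x, contract r x = a ∧ x ≠ r + 1 := by
      refine ⟨if a ≤ r then a else a + 1, ?_⟩
      have := contract_spec r (if a ≤ r then a else a + 1)
      split_ifs at this ⊢ <;> omega
    -- a diagonal `(a, r + 1)` lifts to column `r + 1` if `j < a` and to column `r + 2` if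
    -- `a < j`: then it crosses no nontrivial diagonal of `T` that ends in the other one of the two
    obtain ⟨y, hy, hy'⟩ : ∃ y, contract r y = b ∧ (y = r + 1 → j < a) ∧
        (y = r + 2 → a < j) := by
      have hne : b = r + 1 → a ≠ j := by
        rintro rfl rfl
        refine hn (mem_flat.2 ⟨hd, a, r + 1, hs.left_mem, ?_⟩)
        have := contract_spec r a
        have := contract_spec r (r + 1)
        omega
      by_cases hbr : b ≤ r
      · exact ⟨b, by have := contract_spec r b; omega, by omega, by omega⟩
      · by_cases hbr' : b = r + 1 ∧ j < a
        · exact ⟨b, by have := contract_spec r b; omega, by omega, by omega⟩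
        · exact ⟨b + 1, by have := contract_spec r (b + 1); omega, by omega, by omega⟩
    have hcx := contract_spec r x
    have hcy := contract_spec r y
    have hxy : (x, y) ∉ T := fun hxy => hn (mem_flat.2 ⟨hd, x, y, hxy, hx, hy⟩)
    obtain ⟨c, d, e, f, m1, m2, hh⟩ := h.sat x y (mem_diagonals.2 (by omega)) hxy
    have b1 := h.bounds m1
    have b2 := h.bounds m2
    have o1 := hs.row _ _ m1
    have o2 := hs.row _ _ m2
    have p1 : d = r + 1 → j ≤ c := by rintro rfl; exact hs.le_of_mem h m1
    have p2 : f = r + 1 → j ≤ e := by rintro rfl; exact hs.le_of_mem h m2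
    have p3 : d = r + 2 → c ≤ j ∨ c = r := by rintro rfl; exact hs.ge_of_mem h m1
    have p4 : f = r + 2 → e ≤ j ∨ e = r := by rintro rfl; exact hs.ge_of_mem h m2
    have sc := contract_spec r c
    have sd := contract_spec r d
    have se := contract_spec r e
    have sf := contract_spec r f
    rcases hh with hh | hh | hh
    · have k := contract_crossing (r := r) (by omega) (by omega) (by omega) (by omega) (by omega) hh
      rw [hx, hy] at k
      exact ⟨_, _, _, _, contract_mem_flat h m1 (by omega) (by omega) (by omega),
        contract_mem_flat h m2 (by omega) (by omega) (by omega), Or.inl k⟩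
    · have k := contract_crossing (r := r) (by omega) (by omega) (by omega) (by omega) (by omega) hh
      rw [hx, hy] at k
      exact ⟨_, _, _, _, contract_mem_flat h m1 (by omega) (by omega) (by omega),
        contract_mem_flat h m2 (by omega) (by omega) (by omega), Or.inr (Or.inl k)⟩
    · have k := contract_crossing (r := r) (by omega) (by omega) (by omega) (by omega) (by omega) hh
      rw [hx, hy] at k
      exact ⟨_, _, _, _, contract_mem_flat h m1 (by omega) (by omega) (by omega),
        contract_mem_flat h m2 (by omega) (by omega) (by omega), Or.inr (Or.inr k)⟩

end Flat

section Inflate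

variable {n r j : ℕ} {T : Finset (ℕ × ℕ)}

lemma star_inflate (h : Tri n T) (hj1 : 1 ≤ j) (hj : j < r) (hr : r + 2 ≤ n)
    (hjT : (j, r + 1) ∈ T) (hrow : ∀ a b, (a, b) ∈ T → r < a → b = a + 2) :
    Star (n + 1) (inflate n r j T) r j := by
  have cj := contract_spec r j
  have cr := contract_spec r r
  have c1 := contract_spec r (r + 1)
  have c2 := contract_spec r (r + 2)
  have c3 := contract_spec r (r + 3)
  have e1 : contract r j = j := by omega
  have e2 : contract r r = r := by omega
  have e3 : contract r (r + 1) = r + 1 := by omega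
  have e4 : contract r (r + 2) = r + 1 := by omega
  have e5 : contract r (r + 3) = r + 2 := by omega
  refine ⟨hj1, hj, by omega, ?_, ?_, ?_, ?_⟩
  · refine mem_inflate.2 ⟨mem_diagonals.2 (by omega), Or.inr ⟨?_, by omega, by omega, by omega⟩⟩
    rw [e2, e5]
    exact h.trivial_mem (mem_diagonals.2 (by omega)) (Or.inl rfl)
  · refine mem_inflate.2 ⟨mem_diagonals.2 (by omega), Or.inr ⟨?_, by omega, by omega, by omega⟩⟩
    rwa [e1, e3]
  · refine mem_inflate.2 ⟨mem_diagonals.2 (by omega), Or.inr ⟨?_, by omega, by omega, by omega⟩⟩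
    rwa [e1, e4]
  · intro a b hab ha
    obtain ⟨hd, ⟨h1 | h1⟩ | ⟨h1, -, -, h4⟩⟩ := mem_inflate.1 hab
    · omega
    · omega
    · have ca := contract_spec r a
      have cb := contract_spec r b
      have := hrow _ _ h1 (by omega)
      omega

/-- The splitting of a vertex turns a `2`-triangulation into a `2`-triangulation, if the rows below
`r` contain trivial diagonals only. -/
lemma Tri.inflate (h : Tri n T) (hj1 : 1 ≤ j) (hj : j < r) (hr : r + 2 ≤ n)
    (hjT : (j, r + 1) ∈ T) (hrow : ∀ a b, (a, b) ∈ T → r < a → b = a + 2) :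
    Tri (n + 1) (inflate n r j T) := by
  have hs := star_inflate h hj1 hj hr hjT hrow
  refine ⟨Finset.filter_subset _ _, ?_, ?_⟩
  · have key : ∀ a b, (a, b) ∈ GenTree.inflate n r j T → a + 3 ≤ b →
        a ≤ r ∧ (contract r a, contract r b) ∈ T ∧ (b = r + 1 → j ≤ a) ∧ (b = r + 2 → a ≤ j) := by
      intro a b hab hlt
      have h1 := hs.row _ _ hab
      have h2 := mem_inflate.1 hab
      exact ⟨by omega, (h2.2.resolve_left (by omega)).1,
        (h2.2.resolve_left (by omega)).2.1, (h2.2.resolve_left (by omega)).2.2.1⟩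
    intro a₁ a₂ a₃ b₁ b₂ b₃ m1 m2 m3 h1 h2 h3 h4 h5
    obtain ⟨l1, k1, j1, i1⟩ := key _ _ m1 (by omega)
    obtain ⟨l2, k2, j2, i2⟩ := key _ _ m2 (by omega)
    obtain ⟨l3, k3, j3, i3⟩ := key _ _ m3 (by omega)
    have k := contract_crossing (r := r) (by omega) (by omega) (by omega) (by omega) (by omega)
      ⟨h1, h2, h3, h4, h5⟩
    exact h.free _ _ _ _ _ _ k1 k2 k3 k.1 k.2.1 k.2.2.1 k.2.2.2.1 k.2.2.2.2
  · have lift : ∀ c d, (c, d) ∈ T → c ≤ r →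
        ∃ y, (c, y) ∈ GenTree.inflate n r j T ∧ contract r y = d := by
      intro c d hcd hc
      have hb := h.bounds hcd
      have cc := contract_spec r c
      have ec : contract r c = c := by omega
      rcases Nat.lt_or_ge d (if c < j then r + 1 else r + 2) with h' | h'
      · have cd := contract_spec r d
        have ed : contract r d = d := by split_ifs at h' <;> omega
        refine ⟨d, mem_inflate.2 ⟨mem_diagonals.2 (by omega), Or.inr ⟨by rwa [ec, ed], ?_⟩⟩, ed⟩
        split_ifs at h' <;> omega
      · have cd := contract_spec r (d + 1)
        have ed : contract r (d + 1) = d := by split_ifs at h' <;> omega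
        refine ⟨d + 1, mem_inflate.2 ⟨mem_diagonals.2 ?_, Or.inr ⟨by rwa [ec, ed], ?_⟩⟩, ed⟩
        · omega
        · split_ifs at h' <;> omega
    intro a b hd hn
    have hb := mem_diagonals.1 hd
    have ca := contract_spec r a
    have cb := contract_spec r b
    have hni : ¬((a = r ∧ b = r + 2 ∨ a = r + 1 ∧ b = r + 3) ∨
        (contract r a, contract r b) ∈ T ∧ (b = r + 1 → j ≤ a) ∧ (b = r + 2 → a ≤ j) ∧
          a ≠ r + 1) := fun hh => hn (mem_inflate.2 ⟨hd, hh⟩)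
    have hne : ¬(a = r ∧ b = r + 2 ∨ a = r + 1 ∧ b = r + 3) := fun hh => hni (Or.inl hh)
    have hd' : (contract r a, contract r b) ∈ diagonals n := mem_diagonals.2 (by omega)
    by_cases hT : (contract r a, contract r b) ∈ T
    · have h3 : ¬((b = r + 1 → j ≤ a) ∧ (b = r + 2 → a ≤ j) ∧ a ≠ r + 1) :=
        fun hh => hni (Or.inr ⟨hT, hh⟩)
      -- the diagonal violates the splitting rule, so it crosses two edges of the pentagram
      by_cases hc1 : b = r + 1 ∧ a < j
      · exact ⟨_, _, _, _, hs.right_mem, hs.corner_mem, by omega⟩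
      by_cases hc2 : b = r + 2 ∧ j < a
      · exact ⟨_, _, _, _, hs.left_mem, hs.corner_mem, by omega⟩
      have ha : a = r + 1 := by omega
      have := hrow _ _ hT (by omega)
      exact ⟨_, _, _, _, hs.right_mem, hs.corner_mem, by omega⟩
    · obtain ⟨c, d, e, f, m1, m2, hh⟩ := h.sat _ _ hd' hT
      have b1 := h.bounds m1
      have b2 := h.bounds m2
      have o1 := hrow _ _ m1
      have o2 := hrow _ _ m2
      have hc : c ≤ r := by omega
      have he : e ≤ r := by omega
      obtain ⟨y, my, rfl⟩ := lift c d m1 hc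
      obtain ⟨z, mz, rfl⟩ := lift e f m2 he
      have ec : contract r c = c := by have := contract_spec r c; omega
      have ee : contract r e = e := by have := contract_spec r e; omega
      rw [← ec, ← ee] at hh
      refine ⟨_, _, _, _, my, mz, ?_⟩
      rcases hh with ⟨h1, h2, h3, h4, h5⟩ | ⟨h1, h2, h3, h4, h5⟩ | ⟨h1, h2, h3, h4, h5⟩
      · exact Or.inl ⟨lt_of_contract_lt h1, lt_of_contract_lt h2, lt_of_contract_lt h3,
          lt_of_contract_lt h4, lt_of_contract_lt h5⟩
      · exact Or.inr (Or.inl ⟨lt_of_contract_lt h1, lt_of_contract_lt h2, lt_of_contract_lt h3,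
          lt_of_contract_lt h4, lt_of_contract_lt h5⟩)
      · exact Or.inr (Or.inr ⟨lt_of_contract_lt h1, lt_of_contract_lt h2, lt_of_contract_lt h3,
          lt_of_contract_lt h4, lt_of_contract_lt h5⟩)

lemma flat_inflate (h : Tri n T) (hj1 : 1 ≤ j) (hj : j < r) (hr : r + 2 ≤ n)
    (hrow : ∀ a b, (a, b) ∈ T → r < a → b = a + 2) :
    flat n r (inflate n r j T) = T := by
  ext ⟨a, b⟩
  rw [mem_flat]
  constructor
  · rintro ⟨hd, x, y, hxy, rfl, rfl⟩
    have hd := mem_diagonals.1 hd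
    have cx := contract_spec r x
    have cy := contract_spec r y
    exact ((mem_inflate.1 hxy).2.resolve_left (by omega)).1
  · intro hab
    have hb := h.bounds hab
    refine ⟨h.sub hab, ?_⟩
    have ho := hrow _ _ hab
    have e1 : contract r (if a ≤ r then a else a + 1) = a := by
      have := contract_spec r (if a ≤ r then a else a + 1)
      split_ifs at this ⊢ <;> omega
    have e2 : contract r (if b ≤ r ∨ b = r + 1 ∧ j ≤ a then b else b + 1) = b := by
      have := contract_spec r (if b ≤ r ∨ b = r + 1 ∧ j ≤ a then b else b + 1)
      split_ifs at this ⊢ <;> omega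
    refine ⟨if a ≤ r then a else a + 1, if b ≤ r ∨ b = r + 1 ∧ j ≤ a then b else b + 1, ?_,
      e1, e2⟩
    refine mem_inflate.2 ⟨mem_diagonals.2 ?_, Or.inr ⟨by rwa [e1, e2], ?_⟩⟩
    · split_ifs <;> omega
    · split_ifs <;> omega

/-- A `2`-triangulation is recovered from its contraction and its star. -/
lemma inflate_flat (h : Tri (n + 1) T) (hs : Star (n + 1) T r j) :
    inflate n r j (flat n r T) = T := by
  have hj := hs.lt
  have hr := hs.le
  have hj1 := hs.one_le
  ext ⟨a, b⟩
  rw [mem_inflate]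
  have ca := contract_spec r a
  have cb := contract_spec r b
  constructor
  · rintro ⟨hd, (⟨rfl, rfl⟩ | ⟨rfl, rfl⟩) | ⟨hf, h1, h2, h3⟩⟩
    · exact h.trivial_mem hd (by omega)
    · exact h.trivial_mem hd (by omega)
    · have hb := mem_diagonals.1 hd
      obtain ⟨hd', x, y, hxy, hx, hy⟩ := mem_flat.1 hf
      have hb' := mem_diagonals.1 hd'
      have cx := contract_spec r x
      have cy := contract_spec r y
      have hxyb := h.bounds hxy
      have ho := hs.row _ _ hxy
      by_cases hay : a ≤ r
      · obtain rfl : x = a := by omega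
        rcases lt_trichotomy y b with hlt | rfl | hlt
        · obtain rfl : y = r + 1 := by omega
          obtain rfl : b = r + 2 := by omega
          have := hs.le_of_mem h hxy
          obtain rfl : x = j := by have := h2 rfl; omega
          exact hs.right_mem
        · exact hxy
        · obtain rfl : b = r + 1 := by omega
          obtain rfl : y = r + 2 := by omega
          have := hs.ge_of_mem h hxy
          obtain rfl : x = j := by have := h1 rfl; omega
          exact hs.left_mem
      · exact h.trivial_mem hd (by omega)
  · intro hab
    have hb := h.bounds hab
    refine ⟨h.sub hab, ?_⟩
    have ho := hs.row _ _ hab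
    by_cases htr : a = r ∧ b = r + 2 ∨ a = r + 1 ∧ b = r + 3
    · exact Or.inl htr
    · refine Or.inr ⟨contract_mem_flat h hab (by omega) (by omega) (by omega), ?_, ?_, by omega⟩
      · rintro rfl
        exact hs.le_of_mem h hab
      · rintro rfl
        have := hs.ge_of_mem h hab
        omega

end Inflate

/-! ### Columns of the diagram and of its contraction -/

lemma degree_eq_zero_iff {D : Finset (ℕ × ℕ)} {v : ℕ} :
    degree D v = 0 ↔ ∀ a b, (a, b) ∈ D → a ≠ v ∧ b ≠ v := by
  simp only [degree, Finset.card_eq_zero, Finset.filter_eq_empty_iff, Prod.forall, not_or, ne_eq]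

section Parent

variable {n r j : ℕ} {T : Finset (ℕ × ℕ)}

lemma lastBelow_eq (h : Tri (n + 1) T) (hs : Star (n + 1) T r j)
    (hj : (j, r + 2) ∈ diagram (n + 1) T) : lastBelow (diagram (n + 1) T) r = j := by
  have h1 := hs.lt
  have h2 := hs.one_le
  refine le_antisymm (Finset.sup_le fun a ha => ?_) ?_
  · simp only [Finset.mem_filter, Finset.mem_Ico] at ha
    have := hs.ge_of_mem h ((mem_diagram h.sub).1 ha.2).1
    simp only [id]
    omega
  · exact Finset.le_sup (f := id) (by
      simp only [Finset.mem_filter, Finset.mem_Ico]; exact ⟨by omega, hj⟩)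

/-- The three cases of the parent rule, in terms of the star: either `(j, r + 1)` is trivial, or
`(j, r + 2)` is trivial, or neither is. The diagonal that is deleted is the one that becomes
superfluous or trivial in the contraction. -/
lemma secondDeleted_spec (hn : 5 ≤ n) (h : Tri (n + 1) T) (hs : Star (n + 1) T r j) :
    (j + 1 = r ∧ secondDeleted (diagram (n + 1) T) r = (r - 1, r + 2)) ∨
    (j = 1 ∧ r + 2 = n ∧ j + 1 < r ∧ secondDeleted (diagram (n + 1) T) r = (1, r + 1)) ∨
    (j + 1 < r ∧ ¬(j = 1 ∧ r + 2 = n) ∧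
      secondDeleted (diagram (n + 1) T) r = (j, r + 2)) := by
  have hj := hs.lt
  have hj1 := hs.one_le
  have hr := hs.le
  have d1 : degree (diagram (n + 1) T) (r + 1) = 0 ↔ j + 1 = r := by
    rw [degree_eq_zero_iff]
    constructor
    · intro hd
      by_contra hne
      exact (hd j (r + 1) ((mem_diagram h.sub).2 ⟨hs.left_mem, by omega⟩)).2 rfl
    · intro hjr a b hab
      obtain ⟨hT, hab⟩ := (mem_diagram h.sub).1 hab
      have := hs.row _ _ hT
      refine ⟨by omega, ?_⟩
      rintro rfl
      have := hs.le_of_mem h hT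
      omega
  have d2 : degree (diagram (n + 1) T) (r + 2) = 0 ↔ j = 1 ∧ r + 2 = n := by
    rw [degree_eq_zero_iff]
    constructor
    · intro hd
      by_contra hne
      exact (hd j (r + 2) ((mem_diagram h.sub).2 ⟨hs.right_mem, by omega⟩)).2 rfl
    · intro hjr a b hab
      obtain ⟨hT, hab⟩ := (mem_diagram h.sub).1 hab
      have := hs.row _ _ hT
      refine ⟨by omega, ?_⟩
      rintro rfl
      have := hs.ge_of_mem h hT
      omega
  unfold secondDeleted
  by_cases c1 : j + 1 = r
  · exact Or.inl ⟨c1, by rw [if_pos (d1.2 c1)]⟩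
  · rw [if_neg (d1.not.2 c1)]
    by_cases c2 : j = 1 ∧ r + 2 = n
    · exact Or.inr (Or.inl ⟨c2.1, c2.2, by omega, by rw [if_pos (d2.2 c2)]⟩)
    · rw [if_neg (d2.not.2 c2), lastBelow_eq h hs ((mem_diagram h.sub).2 ⟨hs.right_mem, by omega⟩)]
      exact Or.inr (Or.inr ⟨by omega, c2, rfl⟩)

lemma mem_parentDiagram {D : Finset (ℕ × ℕ)} {x y : ℕ} (hc : corner n D = r) :
    (x, y) ∈ parentDiagram n D ↔ ∃ a b, (a, b) ∈ D ∧ (a, b) ≠ (r, r + 3) ∧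
      (a, b) ≠ secondDeleted D r ∧ contract r a = x ∧ contract r b = y := by
  subst hc
  simp only [parentDiagram, Finset.mem_image, Finset.mem_erase, Prod.exists, Prod.mk.injEq]
  constructor
  · rintro ⟨a, b, ⟨h1, h2, h3⟩, h4, h5⟩
    exact ⟨a, b, h3, by simpa using h2, h1, h4, h5⟩
  · rintro ⟨a, b, h3, h2, h1, h4, h5⟩
    exact ⟨a, b, ⟨h1, by simpa using h2, h3⟩, h4, h5⟩

/-- The parent rule is the contraction of the side `(r + 1, r + 2)`. -/
lemma parentDiagram_eq (hn : 5 ≤ n) (h : Tri (n + 1) T) (hs : Star (n + 1) T r j) :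
    parentDiagram (n + 1) (diagram (n + 1) T) = diagram n (flat n r T) := by
  have hj := hs.lt
  have hj1 := hs.one_le
  have hr := hs.le
  have hF := h.flat hs
  have hspec := secondDeleted_spec hn h hs
  ext ⟨x, y⟩
  rw [mem_parentDiagram (hs.corner_eq (by omega) h), mem_diagram hF.sub]
  constructor
  · rintro ⟨a, b, hab, hne1, hne2, rfl, rfl⟩
    obtain ⟨hT, hab⟩ := (mem_diagram h.sub).1 hab
    have hb := h.bounds hT
    have ho := hs.row _ _ hT
    have ca := contract_spec r a
    have cb := contract_spec r b
    have l1 : b = r + 1 → j ≤ a := by rintro rfl; exact hs.le_of_mem h hT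
    have l2 : b = r + 2 → a ≤ j ∨ a = r := by rintro rfl; exact hs.ge_of_mem h hT
    have hnt : contract r a + 3 ≤ contract r b ∧ contract r b + 3 ≤ contract r a + n := by
      rcases hspec with ⟨k1, k⟩ | ⟨k1, k2, k3, k⟩ | ⟨k1, k2, k⟩ <;>
        (rw [k] at hne2; simp only [ne_eq, Prod.mk.injEq] at hne1 hne2; omega)
    exact ⟨contract_mem_flat h hT (by omega) (by omega) (by omega), hnt⟩
  · rintro ⟨hxy, h1, h2⟩
    have ho := hs.row_flat hxy
    have hxr : x ≤ r := by omega
    obtain ⟨y, hT, rfl⟩ := exists_lift hxy hxr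
    have hb := h.bounds hT
    have cx := contract_spec r x
    have cy := contract_spec r y
    have hmem : (x, y) ∈ diagram (n + 1) T := (mem_diagram h.sub).2 ⟨hT, by omega⟩
    rcases hspec with ⟨k1, k⟩ | ⟨k1, k2, k3, k⟩ | ⟨k1, k2, k⟩
    · exact ⟨x, y, hmem, by rw [ne_eq, Prod.mk.injEq]; omega,
        by rw [k, ne_eq, Prod.mk.injEq]; omega, by omega, rfl⟩
    · exact ⟨x, y, hmem, by rw [ne_eq, Prod.mk.injEq]; omega,
        by rw [k, ne_eq, Prod.mk.injEq]; omega, by omega, rfl⟩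
    · by_cases he : x = j ∧ y = r + 2
      · obtain ⟨rfl, rfl⟩ := he
        have := contract_spec r (r + 1)
        exact ⟨x, r + 1, (mem_diagram h.sub).2 ⟨hs.left_mem, by omega⟩,
          by rw [ne_eq, Prod.mk.injEq]; omega, by rw [k, ne_eq, Prod.mk.injEq]; omega,
          by omega, by omega⟩
      · exact ⟨x, y, hmem, by rw [ne_eq, Prod.mk.injEq]; omega,
          by rw [k, ne_eq, Prod.mk.injEq]; omega, by omega, rfl⟩

end Parent

/-- The rows of the elements of `C` in column `c`. -/
def rows (C : Finset (ℕ × ℕ)) (c : ℕ) : Finset ℕ := (C.filter fun d => d.2 = c).image Prod.fst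

lemma mem_rows {C : Finset (ℕ × ℕ)} {a c : ℕ} : a ∈ rows C c ↔ (a, c) ∈ C := by
  simp [rows]

lemma card_rows (C : Finset (ℕ × ℕ)) (c : ℕ) : (rows C c).card = columnCount C c := by
  refine Finset.card_image_of_injOn ?_
  rintro ⟨a, b⟩ h1 ⟨a', b'⟩ h2 h
  simp only [Finset.coe_filter, Set.mem_ofPred_eq] at h1 h2
  simp only at h
  rw [h, h1.2, h2.2]

lemma columnCount_pos {C : Finset (ℕ × ℕ)} {c : ℕ} :
    0 < columnCount C c ↔ ∃ a, (a, c) ∈ C := by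
  rw [← card_rows, Finset.card_pos]
  exact exists_congr fun a => mem_rows

section Columns

variable {n r j : ℕ} {T : Finset (ℕ × ℕ)}

lemma mem_diagram_flat (h : Tri (n + 1) T) (hs : Star (n + 1) T r j) {a y : ℕ} :
    (a, y) ∈ diagram n (flat n r T) ↔ a + 3 ≤ y ∧ y + 3 ≤ a + n ∧ a ≤ r ∧
      ∃ b, (a, b) ∈ T ∧ contract r b = y := by
  rw [mem_diagram (h.flat hs).sub]
  constructor
  · rintro ⟨hab, h1, h2⟩
    have := hs.row_flat hab
    exact ⟨h1, h2, by omega, exists_lift hab (by omega)⟩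
  · rintro ⟨h1, h2, h3, b, hb, rfl⟩
    refine ⟨mem_flat.2 ⟨?_, a, b, hb, ?_, rfl⟩, h1, h2⟩
    · have := h.bounds hb
      have := hs.le
      have := contract_spec r b
      exact mem_diagonals.2 (by omega)
    · have := contract_spec r a
      omega

lemma columnCount_of_ne (h : Tri (n + 1) T) (hs : Star (n + 1) T r j) {c : ℕ}
    (h1 : c ≠ r + 1) (h2 : c ≠ r + 2) (h3 : c ≠ r + 3) :
    columnCount (diagram (n + 1) T) c = columnCount (diagram n (flat n r T)) (contract r c) := by
  have hr := hs.le
  rw [← card_rows, ← card_rows]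
  congr 1
  ext a
  rw [mem_rows, mem_rows, mem_diagram h.sub, mem_diagram_flat h hs]
  have cc := contract_spec r c
  constructor
  · rintro ⟨hT, k1, k2⟩
    have ho := hs.row _ _ hT
    have hb := h.bounds hT
    exact ⟨by omega, by omega, by omega, c, hT, rfl⟩
  · rintro ⟨k1, k2, k3, b, hT, k4⟩
    have cb := contract_spec r b
    obtain rfl : b = c := by omega
    exact ⟨hT, by omega⟩

lemma columnCount_corner (hn : 5 ≤ n) (h : Tri (n + 1) T) (hs : Star (n + 1) T r j) :
    columnCount (diagram (n + 1) T) (r + 3) =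
      columnCount (diagram n (flat n r T)) (r + 2) + 1 := by
  have hr := hs.le
  have hj := hs.lt
  have hnot : r ∉ rows (diagram n (flat n r T)) (r + 2) := by
    rw [mem_rows, mem_diagram_flat h hs]
    omega
  rw [← card_rows, ← card_rows, ← Finset.card_insert_of_notMem hnot]
  congr 1
  ext a
  rw [Finset.mem_insert, mem_rows, mem_rows, mem_diagram h.sub, mem_diagram_flat h hs]
  have cc := contract_spec r (r + 3)
  constructor
  · rintro ⟨hT, k1, k2⟩
    have ho := hs.row _ _ hT
    have hb := h.bounds hT
    by_cases ha : a = r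
    · exact Or.inl ha
    · exact Or.inr ⟨by omega, by omega, by omega, r + 3, hT, by omega⟩
  · rintro (rfl | ⟨k1, k2, k3, b, hT, k4⟩)
    · exact ⟨hs.corner_mem, by omega⟩
    · have cb := contract_spec r b
      obtain rfl : b = r + 3 := by omega
      exact ⟨hT, by omega⟩

/-- The rows of the split column, before the splitting. -/
lemma mem_rows_flat (h : Tri (n + 1) T) (hs : Star (n + 1) T r j) {a : ℕ} :
    a ∈ rows (diagram n (flat n r T)) (r + 1) ↔
      a + 2 ≤ r ∧ r + 4 ≤ a + n ∧ ((a, r + 1) ∈ T ∨ (a, r + 2) ∈ T) := by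
  rw [mem_rows, mem_diagram_flat h hs]
  constructor
  · rintro ⟨k1, k2, k3, b, hT, k4⟩
    refine ⟨by omega, by omega, ?_⟩
    have cb := contract_spec r b
    rcases cb with cb | cb
    · obtain rfl : b = r + 1 := by omega
      exact Or.inl hT
    · obtain rfl : b = r + 2 := by omega
      exact Or.inr hT
  · rintro ⟨k1, k2, hT | hT⟩
    · exact ⟨by omega, by omega, by omega, r + 1, hT, by have := contract_spec r (r + 1); omega⟩
    · exact ⟨by omega, by omega, by omega, r + 2, hT, by have := contract_spec r (r + 2); omega⟩

lemma mem_rows_right (h : Tri (n + 1) T) (hs : Star (n + 1) T r j) {a : ℕ} :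
    a ∈ rows (diagram (n + 1) T) (r + 2) ↔
      a ≤ j ∧ (a, r + 2) ∈ T ∧ ¬(a = 1 ∧ r + 2 = n) := by
  have hr := hs.le
  have hj := hs.lt
  rw [mem_rows, mem_diagram h.sub]
  constructor
  · rintro ⟨hT, k1, k2⟩
    have := hs.ge_of_mem h hT
    exact ⟨by omega, hT, by omega⟩
  · rintro ⟨k1, hT, k2⟩
    have := h.bounds hT
    exact ⟨hT, by omega⟩

lemma mem_rows_left (h : Tri (n + 1) T) (hs : Star (n + 1) T r j) {a : ℕ} :
    a ∈ rows (diagram (n + 1) T) (r + 1) ↔ a + 2 ≤ r ∧ (a, r + 1) ∈ T := by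
  have hr := hs.le
  rw [mem_rows, mem_diagram h.sub]
  constructor
  · rintro ⟨hT, k1, k2⟩
    exact ⟨by omega, hT⟩
  · rintro ⟨k1, hT⟩
    have := h.bounds hT
    exact ⟨hT, by omega⟩

/-- The split doubles one entry of the column. -/
lemma columnCount_split (hn : 5 ≤ n) (h : Tri (n + 1) T) (hs : Star (n + 1) T r j) :
    columnCount (diagram (n + 1) T) (r + 1) + columnCount (diagram (n + 1) T) (r + 2) =
      columnCount (diagram n (flat n r T)) (r + 1) + 1 := by
  have hr := hs.le
  have hj := hs.lt
  have hj1 := hs.one_le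
  simp only [← card_rows]
  have u := fun a => mem_rows_left h hs (a := a)
  have v := fun a => mem_rows_right h hs (a := a)
  have w := fun a => mem_rows_flat h hs (a := a)
  have l1 : ∀ a, (a, r + 1) ∈ T → j ≤ a ∧ 1 ≤ a ∧ a < r :=
    fun a ha => ⟨hs.le_of_mem h ha, by have := h.bounds ha; omega⟩
  have l2 : ∀ a, (a, r + 2) ∈ T → (a ≤ j ∨ a = r) ∧ 1 ≤ a :=
    fun a ha => ⟨hs.ge_of_mem h ha, (h.bounds ha).1⟩
  by_cases c1 : j + 1 = r
  · have e1 : rows (diagram (n + 1) T) (r + 1) = ∅ := by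
      refine Finset.eq_empty_of_forall_notMem fun a ha => ?_
      have := (u a).1 ha
      have := l1 a this.2
      omega
    have e2 : rows (diagram (n + 1) T) (r + 2) =
        insert j (rows (diagram n (flat n r T)) (r + 1)) := by
      ext a
      rw [Finset.mem_insert, v, w]
      constructor
      · rintro ⟨k1, hT, k2⟩
        have := l2 a hT
        by_cases ha : a = j
        · exact Or.inl ha
        · exact Or.inr ⟨by omega, by omega, Or.inr hT⟩
      · rintro (rfl | ⟨k1, k2, hT | hT⟩)
        · exact ⟨le_rfl, hs.right_mem, by omega⟩
        · have := l1 a hT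
          omega
        · exact ⟨by omega, hT, by omega⟩
    rw [e1, e2, Finset.card_insert_of_notMem (by rw [w]; omega), Finset.card_empty, Nat.zero_add]
  by_cases c2 : j = 1 ∧ r + 2 = n
  · have e1 : rows (diagram (n + 1) T) (r + 2) = ∅ := by
      refine Finset.eq_empty_of_forall_notMem fun a ha => ?_
      have := (v a).1 ha
      have := l2 a this.2.1
      omega
    have e2 : rows (diagram (n + 1) T) (r + 1) =
        insert j (rows (diagram n (flat n r T)) (r + 1)) := by
      ext a
      rw [Finset.mem_insert, u, w]
      constructor
      · rintro ⟨k1, hT⟩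
        have := l1 a hT
        by_cases ha : a = j
        · exact Or.inl ha
        · exact Or.inr ⟨by omega, by omega, Or.inl hT⟩
      · rintro (rfl | ⟨k1, k2, hT | hT⟩)
        · exact ⟨by omega, hs.left_mem⟩
        · exact ⟨by omega, hT⟩
        · have := l2 a hT
          omega
    rw [e1, e2, Finset.card_insert_of_notMem (by rw [w]; omega), Finset.card_empty]
  · have e1 : rows (diagram (n + 1) T) (r + 1) ∪ rows (diagram (n + 1) T) (r + 2) =
        rows (diagram n (flat n r T)) (r + 1) := by
      ext a
      rw [Finset.mem_union, u, v, w]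
      constructor
      · rintro (⟨k1, hT⟩ | ⟨k1, hT, k2⟩)
        · have := l1 a hT
          exact ⟨by omega, by omega, Or.inl hT⟩
        · have := l2 a hT
          exact ⟨by omega, by omega, Or.inr hT⟩
      · rintro ⟨k1, k2, hT | hT⟩
        · exact Or.inl ⟨k1, hT⟩
        · have := l2 a hT
          exact Or.inr ⟨by omega, hT, by omega⟩
    have e2 : rows (diagram (n + 1) T) (r + 1) ∩ rows (diagram (n + 1) T) (r + 2) = {j} := by
      ext a
      rw [Finset.mem_inter, u, v, Finset.mem_singleton]
      constructor
      · rintro ⟨⟨k1, hT⟩, k2, -⟩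
        have := l1 a hT
        omega
      · rintro rfl
        exact ⟨⟨by omega, hs.left_mem⟩, le_rfl, hs.right_mem, c2⟩
    rw [← Finset.card_union_add_card_inter, e1, e2, Finset.card_singleton]

lemma columnCount_right_pos (h : Tri (n + 1) T) (hs : Star (n + 1) T r j) (hr : r + 2 < n) :
    0 < columnCount (diagram (n + 1) T) (r + 2) := by
  rw [← card_rows, Finset.card_pos]
  exact ⟨j, (mem_rows_right h hs).2 ⟨le_rfl, hs.right_mem, by omega⟩⟩

lemma corner_flat_le (h : Tri (n + 1) T) (hs : Star (n + 1) T r j) :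
    corner n (diagram n (flat n r T)) ≤ r := by
  by_contra hlt
  have h2 := (corner_spec (n := n) (D := diagram n (flat n r T)) (by omega)).2.2
  have := ((mem_diagram_flat h hs).1 h2).2.2.1
  omega

end Columns

section Rank

variable {n r : ℕ} {T : Finset (ℕ × ℕ)}

/-- The possible positions of the split of the vertex `r + 1`: its neighbours before `r`. The
neighbour `1` is left out if it becomes trivial. -/
def splitRows (n r : ℕ) (T : Finset (ℕ × ℕ)) : Finset ℕ :=
  (Finset.range r).filter fun a => (a, r + 1) ∈ T ∧ ¬(a = 1 ∧ r + 2 = n)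

lemma mem_splitRows {a : ℕ} :
    a ∈ splitRows n r T ↔ a < r ∧ (a, r + 1) ∈ T ∧ ¬(a = 1 ∧ r + 2 = n) := by
  simp [splitRows]

lemma card_splitRows (hn : 5 ≤ n) (h : Tri n T) (hr : r + 2 ≤ n) (hr2 : 2 ≤ r) :
    (splitRows n r T).card = columnCount (diagram n T) (r + 1) + 1 := by
  rw [← card_rows]
  have hnot : r - 1 ∉ rows (diagram n T) (r + 1) := by
    rw [mem_rows, mem_diagram h.sub]
    omega
  rw [← Finset.card_insert_of_notMem hnot]
  congr 1
  ext a
  rw [Finset.mem_insert, mem_splitRows, mem_rows, mem_diagram h.sub]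
  constructor
  · rintro ⟨h1, hT, h2⟩
    have := h.bounds hT
    by_cases ha : a = r - 1
    · exact Or.inl ha
    · exact Or.inr ⟨hT, by omega⟩
  · rintro (rfl | ⟨hT, h1, h2⟩)
    · exact ⟨by omega, h.trivial_mem (mem_diagonals.2 (by omega)) (by omega), by omega⟩
    · exact ⟨by omega, hT, by omega⟩

/-- The size of column `r + 2` is the number of possible positions of the split up to `j`. -/
lemma columnCount_right {j : ℕ} (h : Tri (n + 1) T) (hs : Star (n + 1) T r j) :
    columnCount (diagram (n + 1) T) (r + 2) =
      ((splitRows n r (flat n r T)).filter fun a => a ≤ j).card := by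
  have hr := hs.le
  have hj := hs.lt
  rw [← card_rows]
  congr 1
  ext a
  rw [Finset.mem_filter, mem_splitRows, mem_rows_right h hs, mem_flat]
  constructor
  · rintro ⟨h1, hT, h2⟩
    have := h.bounds hT
    refine ⟨⟨by omega, ⟨mem_diagonals.2 (by omega), a, r + 2, hT, ?_⟩, h2⟩, h1⟩
    have := contract_spec r a
    have := contract_spec r (r + 2)
    omega
  · rintro ⟨⟨h1, ⟨hd, x, y, hT, hx, hy⟩, h2⟩, h3⟩
    refine ⟨h3, ?_, h2⟩
    have cx := contract_spec r x
    obtain rfl : x = a := by omega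
    rcases contract_spec r y with cy | cy
    · obtain rfl : y = r + 1 := by omega
      have := hs.le_of_mem h hT
      obtain rfl : x = j := by omega
      exact hs.right_mem
    · obtain rfl : y = r + 2 := by omega
      exact hT

lemma Star.mem_flat_left {j : ℕ} (hs : Star (n + 1) T r j) (h : Tri (n + 1) T) :
    (j, r + 1) ∈ flat n r T := by
  have := h.bounds hs.left_mem
  have := hs.le
  have := contract_spec r j
  have := contract_spec r (r + 1)
  exact mem_flat.2 ⟨mem_diagonals.2 (by omega), j, r + 1, hs.left_mem, by omega⟩

lemma exists_card_filter_le (K : Finset ℕ) {k : ℕ} (h1 : 1 ≤ k) (hk : k ≤ K.card) :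
    ∃ j ∈ K, (K.filter fun a => a ≤ j).card = k := by
  induction K using Finset.induction_on_max with
  | empty => simp at hk; omega
  | insert x K hx ih =>
    have hxK : x ∉ K := fun h => lt_irrefl _ (hx x h)
    rw [Finset.card_insert_of_notMem hxK] at hk
    rcases Nat.lt_or_ge K.card k with h | h
    · refine ⟨x, Finset.mem_insert_self _ _, ?_⟩
      rw [Finset.filter_true_of_mem, Finset.card_insert_of_notMem hxK]
      · omega
      · intro a ha
        rcases Finset.mem_insert.1 ha with rfl | ha
        · exact le_rfl
        · exact (hx a ha).le
    · obtain ⟨j, hj, hc⟩ := ih h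
      refine ⟨j, Finset.mem_insert_of_mem hj, ?_⟩
      rw [Finset.filter_insert, if_neg (by have := hx j hj; omega), hc]

/-- A `2`-triangulation is determined by its contraction, its corner, and the size of the
column to the left of the corner. -/
lemma eq_of_flat_eq {T' : Finset (ℕ × ℕ)} {j j' : ℕ} (h : Tri (n + 1) T)
    (hs : Star (n + 1) T r j) (h' : Tri (n + 1) T') (hs' : Star (n + 1) T' r j')
    (hf : flat n r T = flat n r T')
    (hc : columnCount (diagram (n + 1) T) (r + 2) = columnCount (diagram (n + 1) T') (r + 2)) :
    T = T' := by
  have key : ∀ {j j'}, (j', r + 1) ∈ flat n r T → j' < r → 1 ≤ j → j < j' →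
      ((splitRows n r (flat n r T)).filter fun a => a ≤ j).card <
        ((splitRows n r (flat n r T)).filter fun a => a ≤ j').card := by
    intro j j' hm hr hj hlt
    refine Finset.card_lt_card ⟨?_, fun hsub => ?_⟩
    · intro a ha
      rw [Finset.mem_filter] at ha ⊢
      exact ⟨ha.1, by omega⟩
    · have := hsub (Finset.mem_filter.2 ⟨mem_splitRows.2 ⟨hr, hm, by omega⟩, le_rfl⟩)
      rw [Finset.mem_filter] at this
      omega
  rw [columnCount_right h hs, columnCount_right h' hs', ← hf] at hc
  have hjj : j = j' := by
    rcases lt_trichotomy j j' with hlt | heq | hlt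
    · have := key (by rw [hf]; exact hs'.mem_flat_left h') hs'.lt hs.one_le hlt
      omega
    · exact heq
    · have := key (hs.mem_flat_left h) hs.lt hs'.one_le hlt
      omega
  subst hjj
  rw [← inflate_flat h hs, ← inflate_flat h' hs', hf]

/-- Each admissible size of the column to the left of the corner occurs. -/
lemma exists_inflate (hn : 5 ≤ n) (h : Tri n T) (hr : r + 2 ≤ n) (hr2 : 2 ≤ r)
    (hrow : ∀ a b, (a, b) ∈ T → r < a → b = a + 2) {k : ℕ} (hk : 1 ≤ k ∨ r + 2 = n)
    (hk' : k ≤ columnCount (diagram n T) (r + 1) + 1) :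
    ∃ T' j, Tri (n + 1) T' ∧ Star (n + 1) T' r j ∧ flat n r T' = T ∧
      columnCount (diagram (n + 1) T') (r + 2) = k := by
  obtain ⟨j, hj1, hj, hjT, hjk⟩ : ∃ j, 1 ≤ j ∧ j < r ∧ (j, r + 1) ∈ T ∧
      ((splitRows n r T).filter fun a => a ≤ j).card = k := by
    rcases Nat.eq_zero_or_pos k with rfl | hk0
    · refine ⟨1, le_rfl, by omega, h.trivial_mem (mem_diagonals.2 (by omega)) (by omega), ?_⟩
      rw [Finset.card_eq_zero, Finset.filter_eq_empty_iff]
      intro a ha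
      rw [mem_splitRows] at ha
      have := h.bounds ha.2.1
      omega
    · rw [← card_splitRows hn h hr hr2] at hk'
      obtain ⟨j, hj, hjk⟩ := exists_card_filter_le _ hk0 hk'
      rw [mem_splitRows] at hj
      exact ⟨j, (h.bounds hj.2.1).1, hj.1, hj.2.1, hjk⟩
  have hT := h.inflate hj1 hj hr hjT hrow
  have hs := star_inflate h hj1 hj hr hjT hrow
  have hf := flat_inflate h hj1 hj hr hrow
  refine ⟨inflate n r j T, j, hT, hs, hf, ?_⟩
  rw [columnCount_right hT hs, hf, hjk]

end Rank

lemma tri_five_iff {T : Finset (ℕ × ℕ)} : Tri 5 T ↔ T = diagonals 5 := by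
  constructor
  · intro h
    refine Finset.Subset.antisymm h.sub ?_
    rintro ⟨a, b⟩ hd
    have := mem_diagonals.1 hd
    exact h.trivial_mem hd (by omega)
  · rintro rfl
    refine ⟨Finset.Subset.refl _, ?_, fun a b h h' => absurd h h'⟩
    intro a₁ a₂ a₃ b₁ b₂ b₃ m1 m2 m3
    have := mem_diagonals.1 m1
    have := mem_diagonals.1 m2
    have := mem_diagonals.1 m3
    omega

lemma diagram_five {T : Finset (ℕ × ℕ)} (h : Tri 5 T) : diagram 5 T = ∅ := by
  refine Finset.eq_empty_of_forall_notMem ?_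
  rintro ⟨a, b⟩ hab
  obtain ⟨hT, hab⟩ := (mem_diagram h.sub).1 hab
  have := h.bounds hT
  omega

/-! ### The coloring algorithm on column counts -/

lemma columnCount_erase {X : Finset (ℕ × ℕ)} {x : ℕ × ℕ} (hx : x ∈ X) (c : ℕ) :
    columnCount (X.erase x) c = if c = x.2 then columnCount X c - 1 else columnCount X c := by
  unfold columnCount
  rw [Finset.filter_erase]
  split_ifs with h
  · rw [Finset.card_erase_of_mem (Finset.mem_filter.2 ⟨hx, h.symm⟩)]
  · rw [Finset.erase_eq_of_notMem]
    exact fun hm => h (Finset.mem_filter.1 hm).2.symm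

lemma columnCount_insert {X : Finset (ℕ × ℕ)} {x : ℕ × ℕ} (hx : x ∉ X) (c : ℕ) :
    columnCount (insert x X) c = if c = x.2 then columnCount X c + 1 else columnCount X c := by
  unfold columnCount
  rw [Finset.filter_insert]
  by_cases h : c = x.2
  · rw [if_pos h.symm, if_pos h, Finset.card_insert_of_notMem]
    exact fun hm => hx (Finset.mem_filter.1 hm).1
  · rw [if_neg fun h' => h h'.symm, if_neg h]

/-- What the coloring algorithm sees of a state: the blocks, and the numbers of uncolored, blue and
red crosses in each column. -/
@[ext]
structure Counts where
  block : ℕ → ℕ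
  free : ℕ → ℕ
  blue : ℕ → ℕ
  red : ℕ → ℕ

/-- The counts of a state of the algorithm. -/
def Coloring.counts (D : Finset (ℕ × ℕ)) (S : Coloring) : Counts :=
  ⟨S.block, columnCount (D \ (S.blue ∪ S.red)), columnCount S.blue, columnCount S.red⟩

namespace Counts

/-- The effect of coloring a cross of column `x` blue. -/
def colorBlue (C : Counts) (x : ℕ) : Counts :=
  { C with
    free := fun c => if c = x then C.free c - 1 else C.free c
    blue := fun c => if c = x then C.blue c + 1 else C.blue c }

/-- The effect of coloring a cross of column `x` red. -/
def colorRed (C : Counts) (x : ℕ) : Counts :=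
  { C with
    free := fun c => if c = x then C.free c - 1 else C.free c
    red := fun c => if c = x then C.red c + 1 else C.red c }

/-- The effect of merging the blocks `r - 2` and `r - 1`. -/
def merge (C : Counts) (r : ℕ) : Counts :=
  { C with block := fun j => if r - 1 ≤ C.block j then C.block j - 1 else C.block j }

/-- `x` is the leftmost column of block `i` with an uncolored cross. -/
def First (C : Counts) (i x : ℕ) : Prop :=
  0 < C.free x ∧ C.block x = i ∧ ∀ c, 0 < C.free c → C.block c = i → x ≤ c

/-- `x` is the rightmost column of block `i` with an uncolored cross. -/
def Last (C : Counts) (i x : ℕ) : Prop :=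
  0 < C.free x ∧ C.block x = i ∧ ∀ c, 0 < C.free c → C.block c = i → c ≤ x

/-- `r` is the largest index such that row `r` of `D` has a cross in block `r`. -/
def IsIndex (D : Finset (ℕ × ℕ)) (block : ℕ → ℕ) (r : ℕ) : Prop :=
  IsGreatest {i | ∃ c ∈ D, c.1 = i ∧ block c.2 = i} r

/-- One iteration of the algorithm, in terms of counts. Unlike `Coloring.Step`, it is
deterministic. -/
def Step (D : Finset (ℕ × ℕ)) (C C' : Counts) : Prop :=
  ∃ r x y, 2 ≤ r ∧ IsIndex D C.block r ∧ C.First r x ∧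
    ((C.colorBlue x).merge r).Last (r - 2) y ∧ C' = ((C.colorBlue x).merge r).colorRed y

lemma First.unique {C : Counts} {i x y : ℕ} (hx : C.First i x) (hy : C.First i y) : x = y :=
  le_antisymm (hx.2.2 y hy.1 hy.2.1) (hy.2.2 x hx.1 hx.2.1)

lemma Last.unique {C : Counts} {i x y : ℕ} (hx : C.Last i x) (hy : C.Last i y) : x = y :=
  le_antisymm (hy.2.2 x hx.1 hx.2.1) (hx.2.2 y hy.1 hy.2.1)

lemma Step.unique {D : Finset (ℕ × ℕ)} {C C₁ C₂ : Counts} (h₁ : Step D C C₁) (h₂ : Step D C C₂) :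
    C₁ = C₂ := by
  obtain ⟨r, x, y, -, hr, hx, hy, rfl⟩ := h₁
  obtain ⟨r', x', y', -, hr', hx', hy', rfl⟩ := h₂
  obtain rfl := hr.unique hr'
  obtain rfl := hx.unique hx'
  obtain rfl := hy.unique hy'
  rfl

end Counts

section Counting

variable {D : Finset (ℕ × ℕ)} {S S' : Coloring}

lemma mem_uncolored {i : ℕ} {x : ℕ × ℕ} :
    x ∈ S.uncolored D i ↔ x ∈ D \ (S.blue ∪ S.red) ∧ S.block x.2 = i := by
  simp [Coloring.uncolored]

lemma exists_mem_of_free_pos {c : ℕ} (h : 0 < (S.counts D).free c) :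
    ∃ a, (a, c) ∈ D \ (S.blue ∪ S.red) := columnCount_pos.1 h

lemma free_pos_of_mem {x : ℕ × ℕ} (h : x ∈ D \ (S.blue ∪ S.red)) : 0 < (S.counts D).free x.2 :=
  columnCount_pos.2 ⟨x.1, h⟩

lemma first_iff {i : ℕ} {x : ℕ × ℕ} (hx : x ∈ S.uncolored D i) :
    (∀ c ∈ S.uncolored D i, x.2 ≤ c.2) ↔ (S.counts D).First i x.2 := by
  have hx' := mem_uncolored.1 hx
  constructor
  · intro h
    refine ⟨free_pos_of_mem hx'.1, hx'.2, fun c hc hb => ?_⟩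
    obtain ⟨a, ha⟩ := exists_mem_of_free_pos hc
    exact h (a, c) (mem_uncolored.2 ⟨ha, hb⟩)
  · intro h c hc
    have hc := mem_uncolored.1 hc
    exact h.2.2 _ (free_pos_of_mem hc.1) hc.2

lemma last_iff {i : ℕ} {x : ℕ × ℕ} (hx : x ∈ S.uncolored D i) :
    (∀ c ∈ S.uncolored D i, c.2 ≤ x.2) ↔ (S.counts D).Last i x.2 := by
  have hx' := mem_uncolored.1 hx
  constructor
  · intro h
    refine ⟨free_pos_of_mem hx'.1, hx'.2, fun c hc hb => ?_⟩
    obtain ⟨a, ha⟩ := exists_mem_of_free_pos hc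
    exact h (a, c) (mem_uncolored.2 ⟨ha, hb⟩)
  · intro h c hc
    have hc := mem_uncolored.1 hc
    exact h.2.2 _ (free_pos_of_mem hc.1) hc.2

lemma exists_uncolored {i c : ℕ} (h : 0 < (S.counts D).free c) (hb : S.block c = i) :
    ∃ x ∈ S.uncolored D i, x.2 = c := by
  obtain ⟨a, ha⟩ := exists_mem_of_free_pos h
  exact ⟨(a, c), mem_uncolored.2 ⟨ha, hb⟩, rfl⟩

lemma counts_insert_blue {x : ℕ × ℕ} (hx : x ∈ D \ (S.blue ∪ S.red)) :
    ({ S with blue := insert x S.blue } : Coloring).counts D = (S.counts D).colorBlue x.2 := by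
  have hx' : x ∉ S.blue := fun h => by simp [h] at hx
  have he : D \ (insert x S.blue ∪ S.red) = (D \ (S.blue ∪ S.red)).erase x := by
    rw [Finset.insert_union, Finset.sdiff_insert]
  unfold Coloring.counts Counts.colorBlue
  simp only [Counts.mk.injEq, true_and, and_true]
  exact ⟨by funext c; rw [he, columnCount_erase hx], by funext c; rw [columnCount_insert hx']⟩

lemma counts_insert_red {x : ℕ × ℕ} (hx : x ∈ D \ (S.blue ∪ S.red)) :
    ({ S with red := insert x S.red } : Coloring).counts D = (S.counts D).colorRed x.2 := by
  have hx' : x ∉ S.red := fun h => by simp [h] at hx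
  have he : D \ (S.blue ∪ insert x S.red) = (D \ (S.blue ∪ S.red)).erase x := by
    rw [Finset.union_insert, Finset.sdiff_insert]
  unfold Coloring.counts Counts.colorRed
  simp only [Counts.mk.injEq, true_and]
  exact ⟨by funext c; rw [he, columnCount_erase hx], by funext c; rw [columnCount_insert hx']⟩

lemma Coloring.Step.counts (h : Coloring.Step D S S') :
    Counts.Step D (S.counts D) (S'.counts D) := by
  obtain ⟨r, x, y, h2, hr, hx, hxf, hy, hyl, rfl⟩ := h
  have hxf := (first_iff hx).1 hxf
  have hyl := (last_iff hy).1 hyl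
  have hM : (({ S with blue := insert x S.blue } : Coloring).merge r).counts D =
      ((S.counts D).colorBlue x.2).merge r := by
    rw [← counts_insert_blue (mem_uncolored.1 hx).1]
    rfl
  rw [hM] at hyl
  refine ⟨r, x.2, y.2, h2, hr, hxf, hyl, ?_⟩
  rw [counts_insert_red (mem_uncolored.1 hy).1, hM]

lemma exists_step_of_counts {C : Counts} (h : Counts.Step D (S.counts D) C) :
    ∃ S', Coloring.Step D S S' := by
  obtain ⟨r, xc, yc, h2, hr, hx, hy, rfl⟩ := h
  obtain ⟨x, hxm, rfl⟩ := exists_uncolored hx.1 hx.2.1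
  have hM : (({ S with blue := insert x S.blue } : Coloring).merge r).counts D =
      ((S.counts D).colorBlue x.2).merge r := by
    rw [← counts_insert_blue (mem_uncolored.1 hxm).1]
    rfl
  rw [← hM] at hy
  obtain ⟨y, hym, rfl⟩ := exists_uncolored hy.1 hy.2.1
  exact ⟨_, r, x, y, h2, hr, hxm, (first_iff hxm).2 hx, hym, (last_iff hym).2 hy, rfl⟩

/-- The counts reached after `i` iterations do not depend on the choices made. -/
lemma counts_eq_of_reach {i : ℕ} (h : Coloring.Reach D i S) :
    ∀ S', Coloring.Reach D i S' → S.counts D = S'.counts D := by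
  induction h with
  | init => rintro S' ⟨⟩; rfl
  | @step i S S₁ _ hstep ih =>
    intro S' h'
    cases h' with
    | step hr' hstep' =>
      have h1 := hstep.counts
      rw [ih _ hr'] at h1
      exact h1.unique hstep'.counts

lemma block_of_reach {i : ℕ} (h : Coloring.Reach D i S) (c : ℕ) :
    S.block c ≤ c - 3 ∧ c - 3 ≤ S.block c + i := by
  induction h with
  | init => exact ⟨le_rfl, Nat.le_add_right _ _⟩
  | step _ hstep ih =>
    obtain ⟨r, x, y, h2, hr, hx, hxf, hy, hyl, rfl⟩ := hstep
    simp only [Coloring.merge]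
    split_ifs <;> omega

lemma union_subset_of_reach {i : ℕ} (h : Coloring.Reach D i S) : S.blue ∪ S.red ⊆ D := by
  induction h with
  | init => exact Finset.empty_subset _
  | step _ hstep ih =>
    obtain ⟨r, x, y, h2, hr, hx, hxf, hy, hyl, rfl⟩ := hstep
    have hx := (Finset.mem_sdiff.1 (mem_uncolored.1 hx).1).1
    have hy := (Finset.mem_sdiff.1 (mem_uncolored.1 hy).1).1
    intro z hz
    simp only [Coloring.merge, Finset.mem_union, Finset.mem_insert] at hz
    rcases hz with (rfl | hz) | (rfl | hz)
    · exact hx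
    · exact ih (Finset.mem_union_left _ hz)
    · exact hy
    · exact ih (Finset.mem_union_right _ hz)

lemma total_of_reach {i : ℕ} (h : Coloring.Reach D i S) (c : ℕ) :
    (S.counts D).free c + (S.counts D).blue c + (S.counts D).red c = columnCount D c := by
  induction h with
  | init => simp [Coloring.counts, Coloring.init, columnCount]
  | step _ hstep ih =>
    obtain ⟨r, x, y, h2, hr, hx, hy, he⟩ := hstep.counts
    rw [he]
    have hx := hx.1
    have hy := hy.1
    simp only [Counts.colorBlue, Counts.merge, Counts.colorRed] at hx hy ⊢
    by_cases h1 : c = x <;> by_cases h2 : c = y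
    · subst h1; subst h2; simp only [if_true] at hy ⊢; omega
    · subst h1; simp only [if_true, if_neg h2]; omega
    · subst h2; simp only [if_true, if_neg h1] at hy ⊢; omega
    · simp only [if_neg h1, if_neg h2]; omega

end Counting

/-! ### Contraction and the algorithm -/

/-- `C` is a state of the algorithm on a diagram, and `C'` one on its contraction, that correspond
to each other: column `r + 1` of the contraction is represented by the columns `r + 1` and `r + 2`,
of which the left one receives the blue crosses first and the right one the red crosses first. The
corner, in column `r + 3`, accounts for one blue cross, and the doubled diagonal for one red
cross. -/
structure Sim (r : ℕ) (E : Prop) (C' C : Counts) : Prop where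
  block : ∀ c, C.block c = C'.block (contract r c)
  free : ∀ c, c ≠ r + 1 → c ≠ r + 2 → C.free c = C'.free (contract r c)
  blue : ∀ c, c ≠ r + 1 → c ≠ r + 2 →
    C.blue c = C'.blue (contract r c) + if c = r + 3 then 1 else 0
  red : ∀ c, c ≠ r + 1 → c ≠ r + 2 → C.red c = C'.red (contract r c)
  free_pair : C.free (r + 1) + C.free (r + 2) = C'.free (r + 1)
  blue_pair : C.blue (r + 1) + C.blue (r + 2) = C'.blue (r + 1)
  red_pair : C.red (r + 1) + C.red (r + 2) = C'.red (r + 1) + 1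
  blue_order : 0 < C.blue (r + 2) → C.free (r + 1) = 0
  red_order : 0 < C.red (r + 1) → C.free (r + 2) = 0
  order : C.blue (r + 2) = 0 ∨ C.red (r + 1) = 0
  red_pos : E → 0 < C.red (r + 2)

lemma contract_self_add_one (r : ℕ) : contract r (r + 1) = r + 1 := by
  have := contract_spec r (r + 1)
  omega

lemma contract_self_add_two (r : ℕ) : contract r (r + 2) = r + 1 := by
  have := contract_spec r (r + 2)
  omega

lemma contract_eq_iff {r c x : ℕ} (h1 : c ≠ r + 1) (h2 : c ≠ r + 2) :
    contract r c = contract r x ↔ c = x := by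
  have := contract_spec r c
  have := contract_spec r x
  omega

namespace Sim

variable {r : ℕ} {E : Prop} {C' C : Counts}

lemma block_pair (h : Sim r E C' C) : C.block (r + 1) = C.block (r + 2) := by
  rw [h.block, h.block, contract_self_add_one, contract_self_add_two]

lemma free_pos (h : Sim r E C' C) {c : ℕ} (hc : 0 < C.free c) :
    0 < C'.free (contract r c) := by
  by_cases h1 : c = r + 1
  · subst h1
    rw [contract_self_add_one, ← h.free_pair]
    omega
  by_cases h2 : c = r + 2
  · subst h2
    rw [contract_self_add_two, ← h.free_pair]
    omega
  · rwa [← h.free c h1 h2]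

lemma exists_of_free_pos (h : Sim r E C' C) {c' : ℕ} (hc : 0 < C'.free c') :
    ∃ c, contract r c = c' ∧ 0 < C.free c := by
  by_cases h1 : c' = r + 1
  · subst h1
    rw [← h.free_pair] at hc
    rcases Nat.eq_zero_or_pos (C.free (r + 1)) with h0 | h0
    · exact ⟨r + 2, contract_self_add_two r, by omega⟩
    · exact ⟨r + 1, contract_self_add_one r, h0⟩
  · obtain ⟨c, hc', hc1, hc2⟩ : ∃ c, contract r c = c' ∧ c ≠ r + 1 ∧ c ≠ r + 2 := by
      rcases Nat.lt_or_ge c' (r + 1) with h2 | h2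
      · exact ⟨c', by have := contract_spec r c'; omega, by omega⟩
      · exact ⟨c' + 1, by have := contract_spec r (c' + 1); omega, by omega⟩
    exact ⟨c, hc', by rwa [h.free c hc1 hc2, hc']⟩

lemma first (h : Sim r E C' C) {i x : ℕ} (hx : C.First i x) : C'.First i (contract r x) := by
  refine ⟨h.free_pos hx.1, by rw [← h.block, hx.2.1], fun c' hc' hb => ?_⟩
  obtain ⟨c, rfl, hc⟩ := h.exists_of_free_pos hc'
  exact contract_mono (hx.2.2 c hc (by rw [h.block, hb]))

lemma last (h : Sim r E C' C) {i x : ℕ} (hx : C.Last i x) : C'.Last i (contract r x) := by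
  refine ⟨h.free_pos hx.1, by rw [← h.block, hx.2.1], fun c' hc' hb => ?_⟩
  obtain ⟨c, rfl, hc⟩ := h.exists_of_free_pos hc'
  exact contract_mono (hx.2.2 c hc (by rw [h.block, hb]))

lemma exists_first (h : Sim r E C' C) {i x' : ℕ} (hx : C'.First i x') :
    ∃ x, C.First i x ∧ contract r x = x' := by
  classical
  have hex : ∃ x, 0 < C.free x ∧ C.block x = i := by
    obtain ⟨x, rfl, hx0⟩ := h.exists_of_free_pos hx.1
    exact ⟨x, hx0, by rw [h.block, hx.2.1]⟩
  have hf : C.First i (Nat.find hex) :=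
    ⟨(Nat.find_spec hex).1, (Nat.find_spec hex).2, fun c hc hb => Nat.find_min' hex ⟨hc, hb⟩⟩
  exact ⟨_, hf, (h.first hf).unique hx⟩

lemma exists_last (h : Sim r E C' C) {i x' : ℕ} (hx : C'.Last i x') : ∃ x, C.Last i x := by
  classical
  have hb : ∀ x, 0 < C.free x ∧ C.block x = i → x ≤ x' + 1 := by
    rintro x ⟨hx0, hxb⟩
    have := hx.2.2 _ (h.free_pos hx0) (by rw [← h.block, hxb])
    have := contract_spec r x
    omega
  obtain ⟨x, rfl, hx0⟩ := h.exists_of_free_pos hx.1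
  have hxb : 0 < C.free x ∧ C.block x = i := ⟨hx0, by rw [h.block, hx.2.1]⟩
  have hspec := Nat.findGreatest_spec (P := fun x => 0 < C.free x ∧ C.block x = i) (hb x hxb) hxb
  exact ⟨_, hspec.1, hspec.2, fun c hc hcb => Nat.le_findGreatest (hb c ⟨hc, hcb⟩) ⟨hc, hcb⟩⟩

lemma merge (h : Sim r E C' C) (i : ℕ) : Sim r E (C'.merge i) (C.merge i) where
  block c := by simp only [Counts.merge, h.block]
  free := h.free
  blue := h.blue
  red := h.red
  free_pair := h.free_pair
  blue_pair := h.blue_pair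
  red_pair := h.red_pair
  blue_order := h.blue_order
  red_order := h.red_order
  order := h.order
  red_pos := h.red_pos

lemma colorBlue (h : Sim r E C' C) {i x : ℕ} (hx : C.First i x) :
    Sim r E (C'.colorBlue (contract r x)) (C.colorBlue x) := by
  obtain ⟨hx0, hxb, hmin⟩ := hx
  have p1 := h.free_pair
  have p2 := h.blue_pair
  have o1 := h.blue_order
  have o2 := h.red_order
  have o3 := h.order
  refine ⟨h.block, ?_, ?_, h.red, ?_, ?_, h.red_pair, ?_, ?_, ?_, h.red_pos⟩
  · intro c h1 h2
    simp only [Counts.colorBlue, contract_eq_iff h1 h2, h.free c h1 h2]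
  · intro c h1 h2
    simp only [Counts.colorBlue, contract_eq_iff h1 h2, h.blue c h1 h2]
    split_ifs <;> omega
  all_goals
    simp only [Counts.colorBlue]
    have cx := contract_spec r x
    by_cases h1 : x = r + 1
    · subst h1
      simp only [contract_self_add_one, if_true, show ¬ r + 2 = r + 1 by omega, if_false]
      omega
    by_cases h2 : x = r + 2
    · subst h2
      have hz : C.free (r + 1) = 0 := by
        by_contra hne
        have := hmin (r + 1) (by omega) (by rw [h.block_pair, hxb])
        omega
      simp only [contract_self_add_two, if_true, show ¬ r + 1 = r + 2 by omega, if_false]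
      omega
    · simp only [show ¬ r + 1 = x by omega, show ¬ r + 2 = x by omega, if_false,
        show ¬ r + 1 = contract r x by omega]
      assumption

lemma colorRed (h : Sim r E C' C) {i x : ℕ} (hx : C.Last i x) :
    Sim r E (C'.colorRed (contract r x)) (C.colorRed x) := by
  obtain ⟨hx0, hxb, hmax⟩ := hx
  have p1 := h.free_pair
  have p2 := h.red_pair
  have o1 := h.blue_order
  have o2 := h.red_order
  have o3 := h.order
  refine ⟨h.block, ?_, h.blue, ?_, ?_, h.blue_pair, ?_, ?_, ?_, ?_, ?_⟩
  · intro c h1 h2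
    simp only [Counts.colorRed, contract_eq_iff h1 h2, h.free c h1 h2]
  · intro c h1 h2
    simp only [Counts.colorRed, contract_eq_iff h1 h2, h.red c h1 h2]
  rotate_right 1
  · intro hE
    have := h.red_pos hE
    simp only [Counts.colorRed]
    split_ifs <;> omega
  all_goals
    simp only [Counts.colorRed]
    have cx := contract_spec r x
    by_cases h1 : x = r + 1
    · subst h1
      have hz : C.free (r + 2) = 0 := by
        by_contra hne
        have := hmax (r + 2) (by omega) (by rw [← h.block_pair, hxb])
        omega
      simp only [contract_self_add_one, if_true, show ¬ r + 2 = r + 1 by omega, if_false]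
      omega
    by_cases h2 : x = r + 2
    · subst h2
      simp only [contract_self_add_two, if_true, show ¬ r + 1 = r + 2 by omega, if_false]
      omega
    · simp only [show ¬ r + 1 = x by omega, show ¬ r + 2 = x by omega, if_false,
        show ¬ r + 1 = contract r x by omega]
      assumption

lemma step {D D' : Finset (ℕ × ℕ)} (h : Sim r E C' C)
    (hD : ∀ i, Counts.IsIndex D C.block i ↔ Counts.IsIndex D' C'.block i) {C₁ : Counts}
    (hs : Counts.Step D C C₁) : ∃ C₁', Counts.Step D' C' C₁' ∧ Sim r E C₁' C₁ := by
  obtain ⟨i, x, y, h2, hi, hx, hy, rfl⟩ := hs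
  have h' := (h.colorBlue hx).merge i
  exact ⟨_, ⟨i, _, _, h2, (hD i).1 hi, h.first hx, h'.last hy, rfl⟩, h'.colorRed hy⟩

lemma exists_step {D D' : Finset (ℕ × ℕ)} (h : Sim r E C' C)
    (hD : ∀ i, Counts.IsIndex D C.block i ↔ Counts.IsIndex D' C'.block i) {C₁' : Counts}
    (hs : Counts.Step D' C' C₁') : ∃ C₁, Counts.Step D C C₁ := by
  obtain ⟨i, x', y', h2, hi, hx', hy', rfl⟩ := hs
  obtain ⟨x, hx, rfl⟩ := h.exists_first hx'
  have h' := (h.colorBlue hx).merge i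
  obtain ⟨y, hy⟩ := h'.exists_last hy'
  exact ⟨_, i, x, y, h2, (hD i).2 hi, hx, hy, rfl⟩

end Sim

/-- The result of the algorithm, in terms of column counts: it does not get stuck, and at the end
all crosses are colored, `α c` blue and `β c` red ones in each column `c`. -/
def Yields (n : ℕ) (D : Finset (ℕ × ℕ)) (α β : ℕ → ℕ) : Prop :=
  (∀ i < n - 5, ∀ S, Coloring.Reach D i S → ∃ S', Coloring.Step D S S') ∧
  ∀ S, Coloring.Reach D (n - 5) S →
    S.blue ∪ S.red = D ∧ columnCount S.blue = α ∧ columnCount S.red = β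

lemma exists_reach {n : ℕ} {D : Finset (ℕ × ℕ)}
    (h : ∀ i < n, ∀ S, Coloring.Reach D i S → ∃ S', Coloring.Step D S S') :
    ∀ i ≤ n, ∃ S, Coloring.Reach D i S := by
  intro i
  induction i with
  | zero => exact fun _ => ⟨_, Coloring.Reach.init⟩
  | succ i ih =>
    intro hi
    obtain ⟨S, hS⟩ := ih (by omega)
    obtain ⟨S', hS'⟩ := h i (by omega) S hS
    exact ⟨S', hS.step hS'⟩

lemma Yields.unique {n : ℕ} {D : Finset (ℕ × ℕ)} {α β α' β' : ℕ → ℕ} (h : Yields n D α β)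
    (h' : Yields n D α' β') : α = α' ∧ β = β' := by
  obtain ⟨S, hS⟩ := exists_reach h.1 _ le_rfl
  have h1 := h.2 S hS
  have h2 := h'.2 S hS
  exact ⟨h1.2.1.symm.trans h2.2.1, h1.2.2.symm.trans h2.2.2⟩

section Simulation

variable {n r j : ℕ} {T : Finset (ℕ × ℕ)}

/-- The crosses of the diagram that disappear in the contraction do not influence the index that
the algorithm chooses. Those whose contraction is too short are in a block with index less than
their row. The other possible one is in row `1` and becomes `(1, n - 1)`; its block gets the
index `1` only when no iterations are left. -/
lemma isIndex_iff (h : Tri (n + 1) T) (hs : Star (n + 1) T r j) {i : ℕ}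
    (hi : i < n - 5) {block : ℕ → ℕ} (hb : ∀ c, block c ≤ c - 3 ∧ c - 3 ≤ block c + i) (k : ℕ) :
    Counts.IsIndex (diagram (n + 1) T) (fun c => block (contract r c)) k ↔
      Counts.IsIndex (diagram n (flat n r T)) block k := by
  have hr := hs.le
  have hj := hs.lt
  unfold Counts.IsIndex
  have he : {i | ∃ c ∈ diagram (n + 1) T, c.1 = i ∧ block (contract r c.2) = i} =
      {i | ∃ c ∈ diagram n (flat n r T), c.1 = i ∧ block c.2 = i} := by
    ext a
    constructor
    · rintro ⟨⟨a, b⟩, hab, rfl, hbl⟩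
      simp only at hbl
      obtain ⟨hT, h1, h2⟩ := (mem_diagram h.sub).1 hab
      have ho := hs.row _ _ hT
      have hab := h.bounds hT
      have hb1 := hb (contract r b)
      have cb := contract_spec r b
      have hnt : contract r b + 3 ≤ a + n := by
        by_contra hlt
        omega
      exact ⟨(a, contract r b), (mem_diagram_flat h hs).2
        ⟨by omega, hnt, by omega, b, hT, rfl⟩, rfl, hbl⟩
    · rintro ⟨⟨a, b⟩, hab, rfl, hbl⟩
      obtain ⟨h1, h2, h3, y, hT, rfl⟩ := (mem_diagram_flat h hs).1 hab
      have cy := contract_spec r y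
      exact ⟨(a, y), (mem_diagram h.sub).2 ⟨hT, by omega⟩, rfl, hbl⟩
  rw [he]

/-- The first iteration colors a cross of column `r + 3` blue, with `r` the corner, merges the
blocks of columns `r + 1` and `r + 2` and colors one cross red there. -/
lemma sim_init (hn : 5 ≤ n) (h : Tri (n + 1) T) (hs : Star (n + 1) T r j) :
    (∃ C, Counts.Step (diagram (n + 1) T) (Coloring.init.counts (diagram (n + 1) T)) C) ∧
    ∀ C, Counts.Step (diagram (n + 1) T) (Coloring.init.counts (diagram (n + 1) T)) C →
      Sim r (r + 2 < n) (Coloring.init.counts (diagram n (flat n r T))) C := by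
  have hr := hs.le
  have hj := hs.lt
  have hj1 := hs.one_le
  set D := diagram (n + 1) T with hD
  set D' := diagram n (flat n r T) with hD'
  have hinit : ∀ D : Finset (ℕ × ℕ), Coloring.init.counts D =
      ⟨fun c => c - 3, columnCount D, fun _ => 0, fun _ => 0⟩ := by
    intro D
    simp only [Coloring.counts, Coloring.init, Finset.empty_union, Finset.sdiff_empty,
      Counts.mk.injEq, true_and]
    exact ⟨funext fun c => rfl, funext fun c => rfl⟩
  rw [hinit, hinit]
  have hcol : ∀ c, 0 < columnCount D c → 4 ≤ c := by
    intro c hc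
    obtain ⟨a, ha⟩ := columnCount_pos.1 hc
    obtain ⟨hT, h1, h2⟩ := (mem_diagram h.sub).1 ha
    have := h.bounds hT
    omega
  have hidx : Counts.IsIndex D (fun c => c - 3) r := by
    constructor
    · exact ⟨(r, r + 3), (mem_diagram h.sub).2 ⟨hs.corner_mem, by omega⟩, rfl, by simp⟩
    · rintro i ⟨⟨a, b⟩, hab, rfl, hb⟩
      simp only at hb
      obtain ⟨hT, h1, h2⟩ := (mem_diagram h.sub).1 hab
      have := hs.row _ _ hT
      simp only
      omega
  have k1 := columnCount_corner hn h hs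
  have k2 := columnCount_split hn h hs
  have k3 := fun c => columnCount_of_ne h hs (c := c)
  have k4 := columnCount_right_pos h hs
  rw [← hD, ← hD'] at k1 k2
  simp only [← hD, ← hD'] at k3 k4
  set C₀ : Counts := ⟨fun c => c - 3, columnCount D, fun _ => 0, fun _ => 0⟩ with hC₀
  have hfirst : C₀.First r (r + 3) := by
    refine ⟨by simp only [hC₀]; omega, by simp [hC₀], fun c _ hb => ?_⟩
    simp only [hC₀] at hb
    omega
  have hfree : ∀ c, ((C₀.colorBlue (r + 3)).merge r).free c =
      if c = r + 3 then columnCount D c - 1 else columnCount D c := fun c => rfl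
  have hblock : ∀ c, ((C₀.colorBlue (r + 3)).merge r).block c = contract r c - 3 := by
    intro c
    have := contract_spec r c
    simp only [Counts.merge, Counts.colorBlue, hC₀]
    split_ifs <;> omega
  have hpair : ∀ c, 0 < ((C₀.colorBlue (r + 3)).merge r).free c →
      ((C₀.colorBlue (r + 3)).merge r).block c = r - 2 → c = r + 1 ∨ c = r + 2 := by
    intro c hc hb
    rw [hblock] at hb
    rw [hfree] at hc
    have := contract_spec r c
    have := hcol c (by split_ifs at hc <;> omega)
    omega
  have f1 : ((C₀.colorBlue (r + 3)).merge r).free (r + 1) = columnCount D (r + 1) := by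
    rw [hfree, if_neg (by omega)]
  have f2 : ((C₀.colorBlue (r + 3)).merge r).free (r + 2) = columnCount D (r + 2) := by
    rw [hfree, if_neg (by omega)]
  have b1 : ((C₀.colorBlue (r + 3)).merge r).block (r + 1) = r - 2 := by
    rw [hblock, contract_self_add_one]
    omega
  have b2 : ((C₀.colorBlue (r + 3)).merge r).block (r + 2) = r - 2 := by
    rw [hblock, contract_self_add_two]
    omega
  constructor
  · by_cases hv : 0 < columnCount D (r + 2)
    · refine ⟨_, r, r + 3, r + 2, by omega, hidx, hfirst, ⟨by omega, b2, ?_⟩, rfl⟩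
      intro c hc hb
      rcases hpair c hc hb with rfl | rfl <;> omega
    · refine ⟨_, r, r + 3, r + 1, by omega, hidx, hfirst, ⟨by omega, b1, ?_⟩, rfl⟩
      intro c hc hb
      rcases hpair c hc hb with rfl | rfl <;> omega
  · rintro C ⟨r', x, y, -, hidx', hx, hy, rfl⟩
    obtain rfl := hidx'.unique hidx
    obtain rfl := hx.unique hfirst
    have hy' := hpair y hy.1 hy.2.1
    have hyr : 0 < columnCount D (r' + 2) → y = r' + 2 := by
      intro hpos
      have := hy.2.2 (r' + 2) (by omega) b2
      omega
    have hy0 : 0 < columnCount D y := by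
      have := hy.1
      rw [hfree] at this
      split_ifs at this <;> omega
    refine ⟨hblock, ?_, ?_, ?_, ?_, ?_, ?_, ?_, ?_, ?_, ?_⟩
    · intro c h1 h2
      change (if c = y then _ - 1 else (if c = r' + 3 then columnCount D c - 1
        else columnCount D c)) = columnCount D' (contract r' c)
      rw [if_neg (by omega)]
      by_cases h3 : c = r' + 3
      · have := contract_spec r' c
        rw [if_pos h3, h3, k1, show contract r' (r' + 3) = r' + 2 by rw [← h3]; omega]
        rfl
      · rw [if_neg h3, k3 c h1 h2 h3]
    · intro c h1 h2
      change (if c = r' + 3 then 0 + 1 else 0) = 0 + if c = r' + 3 then 1 else 0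
      rw [Nat.zero_add, Nat.zero_add]
    · intro c h1 h2
      change (if c = y then 0 + 1 else 0) = 0
      rw [if_neg (by omega)]
    · change (if r' + 1 = y then ((C₀.colorBlue (r' + 3)).merge r').free (r' + 1) - 1 else
        ((C₀.colorBlue (r' + 3)).merge r').free (r' + 1)) +
        (if r' + 2 = y then ((C₀.colorBlue (r' + 3)).merge r').free (r' + 2) - 1 else
        ((C₀.colorBlue (r' + 3)).merge r').free (r' + 2)) = columnCount D' (r' + 1)
      rw [f1, f2]
      rcases hy' with rfl | rfl
      · rw [if_pos rfl, if_neg (by omega)]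
        omega
      · rw [if_neg (by omega), if_pos rfl]
        omega
    · change (if r' + 1 = r' + 3 then 0 + 1 else 0) + (if r' + 2 = r' + 3 then 0 + 1 else 0) = 0
      rw [if_neg (by omega), if_neg (by omega)]
    · change (if r' + 1 = y then 0 + 1 else 0) + (if r' + 2 = y then 0 + 1 else 0) = 0 + 1
      rcases hy' with rfl | rfl
      · rw [if_pos rfl, if_neg (by omega)]
      · rw [if_neg (by omega), if_pos rfl]
    · change 0 < (if r' + 2 = r' + 3 then 0 + 1 else 0) → _
      rw [if_neg (by omega)]
      intro h0
      omega
    · change 0 < (if r' + 1 = y then 0 + 1 else 0) → (if r' + 2 = y then _ - 1 else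
        ((C₀.colorBlue (r' + 3)).merge r').free (r' + 2)) = 0
      intro h0
      rw [if_neg (by split_ifs at h0 <;> omega), f2]
      split_ifs at h0 <;> omega
    · left
      change (if r' + 2 = r' + 3 then 0 + 1 else 0) = 0
      rw [if_neg (by omega)]
    · intro hE
      change 0 < (if r' + 2 = y then 0 + 1 else 0)
      rw [hyr (k4 hE), if_pos rfl]
      exact Nat.one_pos

/-- The run of the algorithm on a diagram, from the second iteration on, corresponds to its run on
the contraction. -/
lemma exists_sim (hn : 5 ≤ n) (h : Tri (n + 1) T) (hs : Star (n + 1) T r j) :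
    ∀ i ≤ n - 5, ∀ S, Coloring.Reach (diagram (n + 1) T) (i + 1) S →
      ∃ S', Coloring.Reach (diagram n (flat n r T)) i S' ∧
        Sim r (r + 2 < n) (S'.counts (diagram n (flat n r T))) (S.counts (diagram (n + 1) T)) := by
  intro i
  induction i with
  | zero =>
    rintro - S (_ | ⟨hS, hstep⟩)
    cases hS
    exact ⟨_, Coloring.Reach.init, (sim_init hn h hs).2 _ hstep.counts⟩
  | succ i ih =>
    intro hi S₁ hS₁
    obtain ⟨S, hS, hstep⟩ : ∃ S, Coloring.Reach (diagram (n + 1) T) (i + 1) S ∧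
        Coloring.Step (diagram (n + 1) T) S S₁ := by
      cases hS₁ with
      | step hS hstep => exact ⟨_, hS, hstep⟩
    obtain ⟨S', hS', hsim⟩ := ih (by omega) S hS
    have hD := isIndex_iff h hs (i := i) (by omega) (block_of_reach hS')
    have hb : (S.counts (diagram (n + 1) T)).block = fun c =>
      S'.block (contract r c) := funext hsim.block
    obtain ⟨C₁', hC₁', hsim'⟩ := hsim.step (D' := diagram n (flat n r T))
      (by rw [hb]; exact hD) hstep.counts
    obtain ⟨S₁', hS₁'⟩ := exists_step_of_counts hC₁'
    refine ⟨S₁', hS'.step hS₁', ?_⟩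
    rwa [← hC₁'.unique hS₁'.counts]

/-- The result of the algorithm on a diagram, compared with the result on its contraction. -/
lemma exists_yields (hn : 5 ≤ n) (h : Tri (n + 1) T) (hs : Star (n + 1) T r j) {α' β' : ℕ → ℕ}
    (hy : Yields n (diagram n (flat n r T)) α' β') :
    ∃ α β, Yields (n + 1) (diagram (n + 1) T) α β ∧
      (∀ c, c ≠ r + 1 → c ≠ r + 2 →
        α c = α' (contract r c) + (if c = r + 3 then 1 else 0) ∧ β c = β' (contract r c)) ∧
      α (r + 1) + α (r + 2) = α' (r + 1) ∧ β (r + 1) + β (r + 2) = β' (r + 1) + 1 ∧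
      (α (r + 2) = 0 ∨ β (r + 1) = 0) ∧ (r + 2 < n → 0 < β (r + 2)) ∧
      ∀ c, α c + β c = columnCount (diagram (n + 1) T) c := by
  set D := diagram (n + 1) T with hD
  set D' := diagram n (flat n r T) with hD'
  have hstuck : ∀ i < n + 1 - 5, ∀ S, Coloring.Reach D i S → ∃ S', Coloring.Step D S S' := by
    intro i hi S hS
    cases i with
    | zero =>
      cases hS
      obtain ⟨C, hC⟩ := (sim_init hn h hs).1
      exact exists_step_of_counts hC
    | succ i =>
      obtain ⟨S', hS', hsim⟩ := exists_sim hn h hs i (by omega) S hS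
      have hidx := isIndex_iff h hs (i := i) (by omega) (block_of_reach hS')
      have hb : (S.counts D).block = fun c => S'.block (contract r c) := funext hsim.block
      obtain ⟨S₁', hS₁'⟩ := hy.1 i (by omega) S' hS'
      obtain ⟨C, hC⟩ := hsim.exists_step (D := D) (D' := D') (by rw [hb]; exact hidx)
        hS₁'.counts
      exact exists_step_of_counts hC
  obtain ⟨S, hS⟩ := exists_reach hstuck _ le_rfl
  rw [show n + 1 - 5 = n - 5 + 1 by omega] at hS
  obtain ⟨S', hS', hsim⟩ := exists_sim hn h hs _ le_rfl S hS
  obtain ⟨hall, rfl, rfl⟩ := hy.2 S' hS'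
  have hfree' : ∀ c, (S'.counts D').free c = 0 := by
    intro c
    change columnCount (D' \ (S'.blue ∪ S'.red)) c = 0
    rw [hall, Finset.sdiff_self]
    rfl
  have hfree : ∀ c, (S.counts D).free c = 0 := by
    intro c
    by_contra hne
    exact (hsim.free_pos (Nat.pos_of_ne_zero hne)).ne' (hfree' _)
  refine ⟨_, _, ⟨hstuck, fun S₁ hS₁ => ?_⟩, fun c h1 h2 => ⟨hsim.blue c h1 h2, hsim.red c h1 h2⟩,
    hsim.blue_pair, hsim.red_pair, hsim.order, hsim.red_pos, fun c => ?_⟩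
  · rw [show n + 1 - 5 = n - 5 + 1 by omega] at hS₁
    have he := counts_eq_of_reach hS₁ S hS
    refine ⟨Finset.Subset.antisymm (union_subset_of_reach hS₁) ?_, congrArg Counts.blue he,
      congrArg Counts.red he⟩
    intro x hx
    by_contra hxn
    have := free_pos_of_mem (Finset.mem_sdiff.2 ⟨hx, hxn⟩)
    rw [he, hfree] at this
    omega
  · have ht := total_of_reach hS c
    rw [hfree, Nat.zero_add] at ht
    exact ht

end Simulation

/-! ### The codes computed by the algorithm -/

/-- The pair of paths that the algorithm computes for `T` has the codes `p` and `q`. They are the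
numbers of blue and red crosses, read from the last column to the first, and their split index is
given by the corner. -/
def HasCode (n : ℕ) (T : Finset (ℕ × ℕ)) (p q : ℕ → ℕ) : Prop :=
  IsPairCode (n - 4) p q ∧ (6 ≤ n → IsSplit p q (n - 1 - corner n (diagram n T))) ∧
  ∃ α β, Yields n (diagram n T) α β ∧ (∀ j, p j = α (n + 1 - j)) ∧ (∀ j, q j = β (n - j)) ∧
    ∀ c, α c + β c = columnCount (diagram n T) c

lemma HasCode.unique {n : ℕ} {T : Finset (ℕ × ℕ)} {p q p' q' : ℕ → ℕ} (h : HasCode n T p q)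
    (h' : HasCode n T p' q') : p = p' ∧ q = q' := by
  obtain ⟨-, -, α, β, hy, hp, hq, -⟩ := h
  obtain ⟨-, -, α', β', hy', hp', hq', -⟩ := h'
  obtain ⟨rfl, rfl⟩ := hy.unique hy'
  exact ⟨funext fun j => (hp j).trans (hp' j).symm, funext fun j => (hq j).trans (hq' j).symm⟩

lemma isPairCode_one_iff {p q : ℕ → ℕ} :
    IsPairCode 1 p q ↔ p = (fun _ => 0) ∧ q = fun _ => 0 := by
  constructor
  · rintro ⟨-, h0, h0', A, B, hA, hB, hz, hA1, hB1, -⟩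
    constructor
    · funext j
      rcases Nat.lt_trichotomy j 1 with h | rfl | h
      · obtain rfl : j = 0 := by omega
        exact h0
      · have := hA 1
        omega
      · have := hA j
        have := hz j h
        omega
    · funext j
      rcases Nat.lt_trichotomy j 1 with h | rfl | h
      · obtain rfl : j = 0 := by omega
        exact h0'
      · have := hB 1
        omega
      · have := hB j
        have := hz j h
        omega
  · rintro ⟨rfl, rfl⟩
    exact ⟨le_rfl, rfl, rfl, fun _ => 0, fun _ => 0, fun _ => rfl, fun _ => rfl,
      fun _ _ => ⟨rfl, rfl⟩, rfl, rfl, fun t ht ht' => by omega⟩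

lemma hasCode_five {T : Finset (ℕ × ℕ)} (h : Tri 5 T) :
    HasCode 5 T (fun _ => 0) fun _ => 0 := by
  refine ⟨isPairCode_one_iff.2 ⟨rfl, rfl⟩, fun h6 => by omega, fun _ => 0, fun _ => 0, ⟨?_, ?_⟩,
    fun _ => rfl, fun _ => rfl, ?_⟩
  · intro i hi
    omega
  · intro S hS
    rw [diagram_five h] at hS ⊢
    cases hS
    exact ⟨rfl, funext fun c => rfl, funext fun c => rfl⟩
  · intro c
    rw [diagram_five h]
    rfl

/-- The codes of a `2`-triangulation are obtained from those of its contraction by reversing the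
parent rule for codes. -/
lemma HasCode.of_flat {n r j : ℕ} {T : Finset (ℕ × ℕ)} {p' q' : ℕ → ℕ} (hn : 5 ≤ n)
    (h : Tri (n + 1) T) (hs : Star (n + 1) T r j) (hc : HasCode n (flat n r T) p' q') :
    ∃ p q, HasCode (n + 1) T p q ∧ IsSplit p q (n - r) ∧ parentUpper (n - r) p = p' ∧
      parentLower (n - r) q = q' ∧
      p (n - r) + q (n - r - 1) = columnCount (diagram (n + 1) T) (r + 2) := by
  have hr := hs.le
  have hj := hs.lt
  have hj1 := hs.one_le
  obtain ⟨hpc, hsp, α', β', hy, hp', hq', -⟩ := hc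
  obtain ⟨α, β, hyT, hne, hα, hβ, hor, hpos, htot⟩ := exists_yields hn h hs hy
  have hcor := corner_flat_le h hs
  obtain ⟨s, hsr⟩ : ∃ s, s = n - r := ⟨_, rfl⟩
  rw [← hsr]
  have hrs : r = n - s := by omega
  have hα3 : α (r + 3) = α' (r + 2) + 1 := by
    rw [(hne (r + 3) (by omega) (by omega)).1, if_pos rfl,
      show contract r (r + 3) = r + 2 by have := contract_spec r (r + 3); omega]
  -- away from the split column, entries are copied, with the index shifted by the contraction
  have hlow : ∀ c, c ≤ r → α c = α' c ∧ β c = β' c := by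
    intro c hcr
    have h1 := hne c (by omega) (by omega)
    rw [if_neg (by omega), show contract r c = c by have := contract_spec r c; omega] at h1
    exact h1
  have hhigh : ∀ c, r + 2 < c + 1 → c ≠ r + 2 → α (c + 1) = α' c ∧ β (c + 1) = β' c := by
    intro c hcr hc3
    rcases Nat.lt_or_ge (r + 2) c with hlt | hge
    · have h1 := hne (c + 1) (by omega) (by omega)
      rw [if_neg (by omega),
        show contract r (c + 1) = c by have := contract_spec r (c + 1); omega] at h1
      exact h1
    · omega
  have hβ3 : β (r + 3) = β' (r + 2) := by
    rw [(hne (r + 3) (by omega) (by omega)).2,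
      show contract r (r + 3) = r + 2 by have := contract_spec r (r + 3); omega]
  set p : ℕ → ℕ := fun j => α (n + 1 + 1 - j) with hp
  set q : ℕ → ℕ := fun j => β (n + 1 - j) with hq
  have ps : p s = α (r + 2) := by simp only [hp]; congr 1; omega
  have ps1 : p (s + 1) = α (r + 1) := by simp only [hp]; congr 1; omega
  have ps0 : p (s - 1) = α (r + 3) := by simp only [hp]; congr 1; omega
  have qs : q s = β (r + 1) := by simp only [hq]; congr 1; omega
  have qs0 : q (s - 1) = β (r + 2) := by simp only [hq]; congr 1; omega
  have hpsm : ∀ j, j + 1 < s → p j = p' j ∧ q j = q' j := by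
    intro j hjs
    rw [hp', hq']
    simp only [hp, hq]
    have h1 := (hhigh (n + 1 - j) (by omega) (by omega)).1
    rw [show n + 1 + 1 - j = n + 1 - j + 1 by omega]
    refine ⟨h1, ?_⟩
    rcases Nat.lt_or_ge (r + 2) (n - j) with hlt | hge
    · rw [show n + 1 - j = n - j + 1 by omega]
      exact (hhigh (n - j) (by omega) (by omega)).2
    · rw [show n + 1 - j = r + 3 by omega, hβ3]
      congr 1
      omega
  have hup : parentUpper s p = p' := by
    funext j
    unfold parentUpper
    split_ifs with h1 h2 h3
    · exact (hpsm j h1).1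
    · rw [show j = s - 1 by omega, ps0, hα3, hp', Nat.add_sub_cancel]
      congr 1
      omega
    · rw [ps, ps1, hp', show n + 1 - j = r + 1 by omega]
      omega
    · rw [hp']
      simp only [hp]
      rw [show n + 1 + 1 - (j + 1) = n + 1 - j by omega]
      exact (hlow _ (by omega)).1
  have hlo : parentLower s q = q' := by
    funext j
    unfold parentLower
    split_ifs with h1 h2
    · exact (hpsm j h1).2
    · rw [show j = s - 1 by omega, qs0, qs, hq', show n - (s - 1) = r + 1 by omega]
      omega
    · rw [hq']
      simp only [hq]
      rw [show n + 1 - (j + 1) = n - j by omega]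
      exact (hlow _ (by omega)).2
  have hq2 : 3 ≤ s → 0 < q (s - 1) := by
    intro h3
    rw [qs0]
    exact hpos (by omega)
  have hor' : p s = 0 ∨ q s = 0 := by rwa [ps, qs]
  have hp1 : 0 < p (s - 1) := by
    rw [ps0, hα3]
    exact Nat.succ_pos _
  have hsplit : IsSplit p q s := by
    refine ⟨by omega, hor', fun j h2 hjs => ?_⟩
    rcases Nat.lt_or_ge (j + 1) s with hlt | hge
    · obtain ⟨-, -, hmin⟩ := hsp (by omega)
      rw [(hpsm j hlt).1, (hpsm j hlt).2]
      exact hmin j h2 (by omega)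
    · obtain rfl : j = s - 1 := by omega
      exact ⟨hp1, hq2 (by omega)⟩
  have hcode : IsPairCode (n - 4 + 1) p q := by
    refine IsPairCode.of_parent (s := s) ?_ ?_ (by omega) (by omega) hor' hp1 ?_ hq2 ?_
    · rcases Nat.lt_or_ge (0 + 1) s with hlt | hge
      · rw [(hpsm 0 hlt).1]
        exact hpc.2.1
      · omega
    · rcases Nat.lt_or_ge (0 + 1) s with hlt | hge
      · rw [(hpsm 0 hlt).2]
        exact hpc.2.2.1
      · omega
    · rw [qs, qs0]
      omega
    · rwa [hup, hlo]
  refine ⟨p, q, ⟨?_, fun h6 => ?_, α, β, hyT, fun j => rfl, fun j => rfl, htot⟩, hsplit, hup, hlo,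
    ?_⟩
  · rwa [show n + 1 - 4 = n - 4 + 1 by omega]
  · rw [hs.corner_eq h6 h, show n + 1 - 1 - r = s by omega]
    exact hsplit
  · rw [ps, qs0]
    exact htot _

lemma exists_hasCode (ℓ : ℕ) : ∀ T, Tri (ℓ + 5) T → ∃ p q, HasCode (ℓ + 5) T p q := by
  induction ℓ with
  | zero => exact fun T h => ⟨_, _, hasCode_five h⟩
  | succ ℓ ih =>
    intro T h
    have h : Tri (ℓ + 5 + 1) T := by rwa [show ℓ + 5 + 1 = ℓ + 1 + 5 by omega]
    obtain ⟨r, j, hs⟩ := h.exists_star (by omega)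
    obtain ⟨p', q', hc⟩ := ih _ (h.flat hs)
    obtain ⟨p, q, hpq, -⟩ := hc.of_flat (by omega) h hs
    exact ⟨p, q, by rwa [show ℓ + 1 + 5 = ℓ + 5 + 1 by omega]⟩

/-- The parent rule for codes is compatible with the contraction. -/
lemma HasCode.flat {ℓ r j : ℕ} {T : Finset (ℕ × ℕ)} {p q : ℕ → ℕ} (h : Tri (ℓ + 5 + 1) T)
    (hs : Star (ℓ + 5 + 1) T r j) (hc : HasCode (ℓ + 5 + 1) T p q) :
    IsSplit p q (ℓ + 5 - r) ∧ HasCode (ℓ + 5) (flat (ℓ + 5) r T) (parentUpper (ℓ + 5 - r) p)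
      (parentLower (ℓ + 5 - r) q) ∧
    p (ℓ + 5 - r) + q (ℓ + 5 - r - 1) = columnCount (diagram (ℓ + 5 + 1) T) (r + 2) := by
  obtain ⟨p', q', hc'⟩ := exists_hasCode ℓ _ (h.flat hs)
  obtain ⟨p₁, q₁, hpq, h1, rfl, rfl, h4⟩ := hc'.of_flat (by omega) h hs
  obtain ⟨rfl, rfl⟩ := hc.unique hpq
  exact ⟨h1, hc', h4⟩

lemma eq_of_hasCode (ℓ : ℕ) : ∀ {T T' : Finset (ℕ × ℕ)} {p q : ℕ → ℕ}, Tri (ℓ + 5) T →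
    Tri (ℓ + 5) T' → HasCode (ℓ + 5) T p q → HasCode (ℓ + 5) T' p q → T = T' := by
  induction ℓ with
  | zero =>
    intro T T' p q h h' _ _
    rw [tri_five_iff.1 h, tri_five_iff.1 h']
  | succ ℓ ih =>
    rw [show ℓ + 1 + 5 = ℓ + 5 + 1 by omega]
    intro T T' p q h h' hc hc'
    obtain ⟨r, j, hs⟩ := h.exists_star (by omega)
    obtain ⟨r', j', hs'⟩ := h'.exists_star (by omega)
    obtain ⟨h1, h2, h3⟩ := hc.flat h hs
    obtain ⟨h1', h2', h3'⟩ := hc'.flat h' hs'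
    have hr := hs.le
    have hr' := hs'.le
    have hrr := h1.unique h1'
    obtain rfl : r = r' := by omega
    exact eq_of_flat_eq h hs h' hs' (ih (h.flat hs) (h'.flat hs') h2 h2') (h3.symm.trans h3')

lemma exists_tri_of_isPairCode (ℓ : ℕ) : ∀ {p q : ℕ → ℕ}, IsPairCode (ℓ + 1) p q →
    ∃ T, Tri (ℓ + 5) T ∧ HasCode (ℓ + 5) T p q := by
  induction ℓ with
  | zero =>
    intro p q h
    obtain ⟨rfl, rfl⟩ := isPairCode_one_iff.1 h
    exact ⟨_, tri_five_iff.2 rfl, hasCode_five (tri_five_iff.2 rfl)⟩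
  | succ ℓ ih =>
    rw [show ℓ + 1 + 5 = ℓ + 5 + 1 by omega]
    intro p q h
    obtain ⟨s, hs, hsm⟩ := h.exists_split
    obtain ⟨T₀, hT₀, hc₀⟩ := ih (h.parent (by omega) hs)
    have hpos := h.pos_of_split (by omega) hs
    have hs2 := hs.1
    obtain ⟨r, hr⟩ : ∃ r, r = ℓ + 5 - s := ⟨_, rfl⟩
    obtain ⟨-, hsp, α, β, -, hp, hq, htot⟩ := id hc₀
    have hrow : ∀ a b, (a, b) ∈ T₀ → r < a → b = a + 2 := by
      intro a b hab ha
      have hb := hT₀.bounds hab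
      rcases Nat.eq_zero_or_pos ℓ with rfl | hℓ
      · omega
      -- the corner of `T₀` is at most `r`, since its split index is at least `s - 1`
      refine hT₀.row_of_corner_lt hab ?_ (by omega) (by omega)
      obtain ⟨k1, k2, -⟩ := hsp (by omega)
      by_contra hlt
      set t := ℓ + 5 - 1 - corner (ℓ + 5) (diagram (ℓ + 5) T₀)
      have := hs.2.2 t (by omega) (by omega)
      rw [parentUpper, parentLower, if_pos (by omega), if_pos (by omega)] at k2
      omega
    have hcol : columnCount (diagram (ℓ + 5) T₀) (r + 1) =
        p s + p (s + 1) + (q (s - 1) + q s - 1) := by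
      have h1 := hp s
      have h2 := hq (s - 1)
      rw [parentUpper, if_neg (by omega), if_neg (by omega), if_pos rfl,
        show ℓ + 5 + 1 - s = r + 1 by omega] at h1
      rw [parentLower, if_neg (by omega), if_pos (by omega),
        show ℓ + 5 - (s - 1) = r + 1 by omega] at h2
      rw [← htot, h1, h2]
    obtain ⟨T, j, hT, hst, hf, hcc⟩ := exists_inflate (n := ℓ + 5) (r := r) (by omega) hT₀
      (by omega) (by omega) hrow (k := p s + q (s - 1))
      (by
        rcases Nat.lt_or_ge 2 s with h3 | h3
        · have := hs.2.2 (s - 1) (by omega) (by omega)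
          omega
        · omega)
      (by omega)
    rw [← hf] at hc₀
    obtain ⟨p₁, q₁, hc₁, hs₁, hu, hl, hsum⟩ := hc₀.of_flat (by omega) hT hst
    rw [show ℓ + 5 - r = s by omega] at hs₁ hu hl hsum
    have hpos₁ := IsPairCode.pos_of_split (m := ℓ + 5 + 1 - 4) hc₁.1 (by omega) hs₁
    obtain ⟨rfl, rfl⟩ := eq_of_parent_eq hs2 hs₁.2.1 hs.2.1 hpos₁.1 hpos.1 hpos₁.2 hpos.2 hu hl
      (hsum.trans hcc)
    exact ⟨T, hT, hc₁⟩

lemma HasCode.algorithmYields {n : ℕ} {T : Finset (ℕ × ℕ)} {p q : ℕ → ℕ}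
    (h : HasCode n T p q) :
    AlgorithmYields n (diagram n T) (ofCode (n - 4) p) (ofCode (n - 4) q) := by
  obtain ⟨-, -, α, β, hy, hp, hq, -⟩ := h
  refine ⟨hy.1, fun S hS => ?_⟩
  obtain ⟨h1, rfl, rfl⟩ := hy.2 S hS
  refine ⟨h1, path_congr fun i hi => ?_, path_congr fun i hi => ?_⟩
  · rw [hp]
    congr 1
    omega
  · rw [hq]
    congr 1
    omega

/-! ### The two trees -/

/-- `w` is the pair of paths that the coloring algorithm computes for `T`. -/
def Matches (ℓ : ℕ) (T : TwoTriangulation (ℓ + 5)) (w : DyckPair (ℓ + 1)) : Prop :=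
  ∃ p q, HasCode (ℓ + 5) T.1 p q ∧ w.1.1.toList = ofCode (ℓ + 1) p ∧
    w.1.2.toList = ofCode (ℓ + 1) q

lemma TwoTriangulation.tri {n : ℕ} (T : TwoTriangulation n) : Tri n T.1 :=
  isTriangulation_iff.1 T.2

lemma DyckPair.ext_toList {m : ℕ} {v w : DyckPair m} (h1 : v.1.1.toList = w.1.1.toList)
    (h2 : v.1.2.toList = w.1.2.toList) : v = w :=
  Subtype.ext (Prod.ext (DyckWord.ext h1) (DyckWord.ext h2))

/-- The parent of a `2`-triangulation is its contraction at the star. -/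
lemma isParent_iff_eq_flat {ℓ r j : ℕ} {x : TwoTriangulation (ℓ + 5 + 1)}
    (hs : Star (ℓ + 5 + 1) x.1 r j) (y : TwoTriangulation (ℓ + 5)) :
    triangulationTree.IsParent ℓ x y ↔ y.1 = flat (ℓ + 5) r x.1 := by
  change diagram (ℓ + 5) y.1 = parentDiagram (ℓ + 5 + 1) (diagram (ℓ + 5 + 1) x.1) ↔ _
  rw [parentDiagram_eq (by omega) x.tri hs]
  exact ⟨fun h => y.tri.eq_of_diagram_eq (x.tri.flat hs) h, fun h => by rw [h]⟩

lemma parentPaths_ofCode {m s : ℕ} {p q : ℕ → ℕ} (h : IsPairCode (m + 1) p q)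
    (hs : IsSplit p q s) : parentPaths (m + 1) (ofCode (m + 1) p) (ofCode (m + 1) q) =
      (ofCode m (parentUpper s p), ofCode m (parentLower s q)) := by
  simp only [parentPaths, h.code_eq.1, h.code_eq.2, hs.splitIndex_eq, Nat.add_sub_cancel]

lemma exists_matches {ℓ : ℕ} (T : TwoTriangulation (ℓ + 5)) : ∃ w, Matches ℓ T w := by
  obtain ⟨p, q, h⟩ := exists_hasCode ℓ T.1 T.tri
  obtain ⟨w, h1, h2⟩ := h.1.exists_pair
  exact ⟨w, p, q, h, h1, h2⟩

lemma eq_of_ofCode_eq {m : ℕ} {p q p' q' : ℕ → ℕ} (h : IsPairCode m p q) (h' : IsPairCode m p' q')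
    (h1 : ofCode m p = ofCode m p') (h2 : ofCode m q = ofCode m q') : p = p' ∧ q = q' :=
  ⟨by rw [← h.code_eq.1, h1, h'.code_eq.1], by rw [← h.code_eq.2, h2, h'.code_eq.2]⟩

lemma Matches.injective {ℓ : ℕ} {T T' : TwoTriangulation (ℓ + 5)} {w : DyckPair (ℓ + 1)}
    (h : Matches ℓ T w) (h' : Matches ℓ T' w) : T = T' := by
  obtain ⟨p, q, hc, h1, h2⟩ := h
  obtain ⟨p', q', hc', h1', h2'⟩ := h'
  obtain ⟨rfl, rfl⟩ := eq_of_ofCode_eq (m := ℓ + 1) hc.1 hc'.1 (h1.symm.trans h1')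
    (h2.symm.trans h2')
  exact Subtype.ext (eq_of_hasCode ℓ T.tri T'.tri hc hc')

lemma Matches.surjective {ℓ : ℕ} (w : DyckPair (ℓ + 1)) : ∃ T, Matches ℓ T w := by
  obtain ⟨p, q, h, h1, h2⟩ := exists_isPairCode (by omega) w
  obtain ⟨T, hT, hc⟩ := exists_tri_of_isPairCode ℓ h
  exact ⟨⟨T, isTriangulation_iff.2 hT⟩, p, q, hc, h1, h2⟩

lemma Matches.isParent_iff {ℓ : ℕ} {x : TwoTriangulation (ℓ + 5 + 1)} {w : DyckPair (ℓ + 1 + 1)}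
    {y : TwoTriangulation (ℓ + 5)} {v : DyckPair (ℓ + 1)} (hx : Matches (ℓ + 1) x w)
    (hy : Matches ℓ y v) :
    triangulationTree.IsParent ℓ x y ↔ dyckTree.IsParent ℓ w v := by
  obtain ⟨r, j, hs⟩ := x.tri.exists_star (by omega)
  obtain ⟨p, q, hc, h1, h2⟩ := hx
  obtain ⟨p', q', hc', h1', h2'⟩ := hy
  obtain ⟨hsp, hcf, -⟩ := HasCode.flat (ℓ := ℓ) x.tri hs hc
  rw [isParent_iff_eq_flat hs]
  change _ ↔ (v.1.1.toList, v.1.2.toList) = parentPaths (ℓ + 1 + 1) w.1.1.toList w.1.2.toList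
  rw [h1, h2, h1', h2', parentPaths_ofCode (m := ℓ + 1) hc.1 hsp, Prod.mk.injEq]
  constructor
  · intro he
    rw [he] at hc'
    obtain ⟨rfl, rfl⟩ := hc'.unique hcf
    exact ⟨rfl, rfl⟩
  · rintro ⟨k1, k2⟩
    obtain ⟨rfl, rfl⟩ := eq_of_ofCode_eq (m := ℓ + 1) hc'.1 hcf.1 k1 k2
    exact eq_of_hasCode ℓ y.tri (x.tri.flat hs) hc' hcf

lemma isRootedTree_triangulationTree : triangulationTree.IsRootedTree := by
  refine ⟨⟨⟨diagonals 5, isTriangulation_iff.2 (tri_five_iff.2 rfl)⟩, trivial, fun y _ => ?_⟩,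
    fun ℓ x => ?_⟩
  · exact Subtype.ext (tri_five_iff.1 (TwoTriangulation.tri (n := 5) y))
  · obtain ⟨r, j, hs⟩ := (TwoTriangulation.tri (n := ℓ + 5 + 1) x).exists_star (by omega)
    have hx := (TwoTriangulation.tri (n := ℓ + 5 + 1) x).flat hs
    refine ⟨⟨_, isTriangulation_iff.2 hx⟩, (isParent_iff_eq_flat hs _).2 rfl, fun y hy => ?_⟩
    exact Subtype.ext ((isParent_iff_eq_flat hs y).1 hy)

lemma isRootedTree_dyckTree : dyckTree.IsRootedTree := by
  constructor
  · obtain ⟨w, h1, h2⟩ := (isPairCode_one_iff.2 ⟨rfl, rfl⟩).exists_pair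
    refine ⟨w, trivial, fun (v : DyckPair 1) _ => ?_⟩
    obtain ⟨p, q, h, h1', h2'⟩ := exists_isPairCode le_rfl v
    obtain ⟨rfl, rfl⟩ := isPairCode_one_iff.1 h
    exact DyckPair.ext_toList (h1'.trans h1.symm) (h2'.trans h2.symm)
  · intro ℓ (x : DyckPair (ℓ + 1 + 1))
    obtain ⟨p, q, h, h1, h2⟩ := exists_isPairCode (by omega) x
    obtain ⟨s, hs, -⟩ := h.exists_split
    obtain ⟨v, h1', h2'⟩ := (h.parent (by omega) hs).exists_pair
    have hpar : parentPaths (ℓ + 2) x.1.1.toList x.1.2.toList =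
        (v.1.1.toList, v.1.2.toList) := by
      rw [h1, h2, h1', h2']
      exact parentPaths_ofCode h hs
    refine ⟨v, hpar.symm, fun (y : DyckPair (ℓ + 1)) hy => ?_⟩
    have hy : (y.1.1.toList, y.1.2.toList) = parentPaths (ℓ + 2) x.1.1.toList x.1.2.toList := hy
    rw [hpar, Prod.mk.injEq] at hy
    exact DyckPair.ext_toList hy.1 hy.2

/-- The bijection computed by the coloring algorithm. -/
noncomputable def coloringEquiv (ℓ : ℕ) : TwoTriangulation (ℓ + 5) ≃ DyckPair (ℓ + 1) :=
  Equiv.ofBijective (fun T => (exists_matches T).choose) <| by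
    refine ⟨fun T T' h => ?_, fun w => ?_⟩
    · have h1 := (exists_matches T).choose_spec
      have h2 := (exists_matches T').choose_spec
      simp only at h
      rw [h] at h1
      exact h1.injective h2
    · obtain ⟨T, hT⟩ := Matches.surjective w
      refine ⟨T, ?_⟩
      obtain ⟨p, q, hc, h1, h2⟩ := hT
      obtain ⟨p', q', hc', h1', h2'⟩ := (exists_matches T).choose_spec
      obtain ⟨rfl, rfl⟩ := hc.unique hc'
      exact DyckPair.ext_toList (h1'.trans h1.symm) (h2'.trans h2.symm)

lemma matches_coloringEquiv {ℓ : ℕ} (T : TwoTriangulation (ℓ + 5)) :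
    Matches ℓ T (coloringEquiv ℓ T) := (exists_matches T).choose_spec

end GenTree

/-- Both families are generating trees, and there is an isomorphism between them; its components
are bijections from the `2`-triangulations of the `n`-gon, `n = ℓ + 5`, to the pairs `(P, Q)` of
Dyck paths of size `n - 4` with `P` never below `Q`, and they are computed by the coloring
algorithm. -/
theorem mainTheorem1 :
    GenTree.triangulationTree.IsRootedTree ∧ GenTree.dyckTree.IsRootedTree ∧
    ∃ Φ : GenTree.Levelled.Iso GenTree.triangulationTree GenTree.dyckTree,
      ∀ (ℓ : ℕ) (T : GenTree.TwoTriangulation (ℓ + 5)) (PQ : GenTree.DyckPair (ℓ + 1)),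
        Φ.toEquiv ℓ T = PQ →
          GenTree.AlgorithmYields (ℓ + 5) (GenTree.diagram (ℓ + 5) T.1)
            PQ.1.1.toList PQ.1.2.toList := by
  refine ⟨GenTree.isRootedTree_triangulationTree, GenTree.isRootedTree_dyckTree,
    ⟨GenTree.coloringEquiv, fun ℓ x y => ?_⟩, ?_⟩
  · exact GenTree.Matches.isParent_iff (GenTree.matches_coloringEquiv (ℓ := ℓ + 1) x)
      (GenTree.matches_coloringEquiv y)
  · rintro ℓ T PQ rfl
    obtain ⟨p, q, hc, h1, h2⟩ := GenTree.matches_coloringEquiv T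
    have h := hc.algorithmYields
    change GenTree.AlgorithmYields _ _ (GenTree.coloringEquiv ℓ T).1.1.toList
      (GenTree.coloringEquiv ℓ T).1.2.toList
    rw [h1, h2]
    exact h
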